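/- An operator space is a norm-closed linear subspace $E\subseteq B(H)$ for a complex Hilbert space $H$, with $M_n(E)$ normed as a subspace of $M_n(B(H))=B(H^{\oplus n})$; the cb norm of a linear map $T$ between matrix normed spaces is $\|T\|_{cb}=\sup_n\|\mathrm{id}_{M_n}\otimes T\|\in[0,\infty]$. The complex conjugate $\overline E=\{\bar x: x\in E\}\subseteq B(\overline H)$ is again an operator space, and for $E\subseteq B(H)$, $F\subseteq B(K)$ the minimal tensor norm $\|\cdot\|_{E\otimes_{\min}F}$ is the operator norm on $H\otimes_2K$. For a set $I$, $OH(I)$ is the Hilbert space $\ell^2(I)$ with canonical basis $(T_i)$ and the matrix norms $\|\sum_i a_i\otimes T_i\|_{M_n(OH(I))}=\|\sum_i a_i\otimes\overline{a_i}\|^{1/2}$, $a_i\in M_n(\mathbb C)$. For a linear map $w:E\to Y$ from an operator space to a normed space, $\pi_{2,oh}(w)\in[0,\infty]$ is the infimum of the constants $C\ge 0$ such that $\sum_i\|w(x_i)\|^2\le C^2\,\big\|\sum_i x_i\otimes\bar x_i\big\|_{E\otimes_{\min}\overline E}$ for all finite sequences $(x_i)$ in $E$ (and $\infty$ if there is no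 such $C$). For a linear map $T:E\to F$ between operator spaces put $$\delta(T)=\inf\{\|v\|_{cb}\,\pi_{2,oh}(w)\}\in[0,\infty],$$ the infimum being over all sets $I$ and all linear maps $w:E\to OH(I)$, $v:OH(I)\to F$ with $T=vw$ (with $0\cdot\infty=0$ and $\inf\emptyset=\infty$). **Proposition ($\delta$ is a 1-injective operator ideal norm).** For all operator spaces $D,E,F,G$ and all linear maps $S,T:E\to F$: 1. $\delta(T)=0$ if and only if $T=0$; $\delta(cT)=|c|\,\delta(T)$ for all $c\in\mathbb C$; and $\delta(S+T)\le\delta(S)+\delta(T)$; 2. $\|T\|_{cb}\le\delta(T)$; 3. $\delta(bTa)\le\|b\|_{cb}\,\delta(T)\,\|a\|_{cb}$ for all completely bounded linear maps $a:D\to E$ and $b:F\to G$; 4. (1-injectivity) $\delta(iT)=\delta(T)$ for every completely isometric linear map $i:F\to G$. -/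

import Mathlib

open scoped TensorProduct ENNReal NNReal

universe u

noncomputable section

/-! ### Complex conjugate Hilbert spaces -/

/-- The complex conjugate `V̄` of a complex vector space `V`: the same additive group (and the same
norm), with scalar multiplication `c • x̄ = conj (c̄ • x)`. -/
def ConjSpace (V : Type*) : Type _ := V

namespace ConjSpace

/-- The canonical antilinear bijection `x ↦ x̄` from `V` to `V̄`. -/
def bar {V : Type*} (x : V) : ConjSpace V := x

/-- The inverse of `x ↦ x̄`. -/
def unbar {V : Type*} (x : ConjSpace V) : V := x

instance {V : Type*} [NormedAddCommGroup V] : NormedAddCommGroup (ConjSpace V) :=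
  inferInstanceAs (NormedAddCommGroup V)

instance {V : Type*} [NormedAddCommGroup V] [CompleteSpace V] : CompleteSpace (ConjSpace V) :=
  inferInstanceAs (CompleteSpace V)

instance {V : Type*} [NormedAddCommGroup V] [Module ℂ V] : Module ℂ (ConjSpace V) where
  smul c x := bar ((starRingEnd ℂ c) • unbar x)
  one_smul x := by
    change (starRingEnd ℂ 1) • unbar x = unbar x
    simp
  mul_smul c d x := by
    change (starRingEnd ℂ (c * d)) • unbar x
      = (starRingEnd ℂ c) • ((starRingEnd ℂ d) • unbar x)
    rw [map_mul, mul_smul]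
  smul_zero c := by
    change (starRingEnd ℂ c) • (0 : V) = 0
    simp
  smul_add c x y := by
    change (starRingEnd ℂ c) • (unbar x + unbar y)
      = (starRingEnd ℂ c) • unbar x + (starRingEnd ℂ c) • unbar y
    rw [smul_add]
  add_smul c d x := by
    change (starRingEnd ℂ (c + d)) • unbar x
      = (starRingEnd ℂ c) • unbar x + (starRingEnd ℂ d) • unbar x
    rw [map_add, add_smul]
  zero_smul x := by
    change (starRingEnd ℂ 0) • unbar x = (0 : V)
    simp

theorem unbar_smul {V : Type*} [NormedAddCommGroup V] [Module ℂ V] (c : ℂ) (x : ConjSpace V) :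
    unbar (c • x) = (starRingEnd ℂ c) • unbar x := rfl

instance {V : Type*} [NormedAddCommGroup V] [NormedSpace ℂ V] : NormedSpace ℂ (ConjSpace V) where
  norm_smul_le c x := by
    change ‖(starRingEnd ℂ c) • unbar x‖ ≤ ‖c‖ * ‖unbar x‖
    rw [norm_smul, RCLike.norm_conj]

/-- On `H̄` the inner product is `⟪x̄, ȳ⟫ = ⟪y, x⟫`. -/
instance {H : Type*} [NormedAddCommGroup H] [InnerProductSpace ℂ H] :
    InnerProductSpace ℂ (ConjSpace H) where
  inner x y := inner ℂ (unbar y) (unbar x)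
  norm_sq_eq_re_inner x := norm_sq_eq_re_inner (𝕜 := ℂ) (unbar x)
  conj_inner_symm x y := inner_conj_symm (𝕜 := ℂ) (unbar y) (unbar x)
  add_left x y z := inner_add_right (𝕜 := ℂ) (unbar z) (unbar x) (unbar y)
  smul_left x y c := inner_smul_right (𝕜 := ℂ) (unbar y) (unbar x) ((starRingEnd ℂ) c)

variable {H : Type*} [NormedAddCommGroup H] [InnerProductSpace ℂ H]

/-- The operator `T̄` on `H̄`, given by `T̄ x̄ = conj (T x)`. -/
def barOp (T : H →L[ℂ] H) : ConjSpace H →L[ℂ] ConjSpace H where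
  toFun x := bar (T (unbar x))
  map_add' x y := T.map_add (unbar x) (unbar y)
  map_smul' c x := T.map_smul ((starRingEnd ℂ) c) (unbar x)
  cont := T.continuous

/-- The inverse of `T ↦ T̄`. -/
def unbarOp (S : ConjSpace H →L[ℂ] ConjSpace H) : H →L[ℂ] H where
  toFun x := unbar (S (bar x))
  map_add' x y := S.map_add (bar x) (bar y)
  map_smul' c x := by
    have h := S.map_smul ((starRingEnd ℂ) c) (bar x)
    have h1 : ((starRingEnd ℂ) c) • (bar x) = bar (c • x) := by
      change bar ((starRingEnd ℂ ((starRingEnd ℂ) c)) • x) = bar (c • x)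
      rw [Complex.conj_conj]
    rw [h1] at h
    rw [h, unbar_smul, Complex.conj_conj]
    rfl
  cont := S.continuous

theorem unbarOp_barOp (T : H →L[ℂ] H) : unbarOp (barOp T) = T := rfl

theorem barOp_unbarOp (S : ConjSpace H →L[ℂ] ConjSpace H) : barOp (unbarOp S) = S := rfl

theorem unbarOp_add (S T : ConjSpace H →L[ℂ] ConjSpace H) :
    unbarOp (S + T) = unbarOp S + unbarOp T := rfl

theorem unbarOp_smul (c : ℂ) (S : ConjSpace H →L[ℂ] ConjSpace H) :
    unbarOp (c • S) = (starRingEnd ℂ c) • unbarOp S := rfl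

theorem norm_unbarOp_le (S : ConjSpace H →L[ℂ] ConjSpace H) : ‖unbarOp S‖ ≤ ‖S‖ :=
  ContinuousLinearMap.opNorm_le_bound _ (norm_nonneg S) fun x => S.le_opNorm (bar x)

theorem continuous_unbarOp :
    Continuous (unbarOp : (ConjSpace H →L[ℂ] ConjSpace H) → (H →L[ℂ] H)) := by
  let φ : (ConjSpace H →L[ℂ] ConjSpace H) →+ (H →L[ℂ] H) :=
    { toFun := unbarOp, map_zero' := rfl, map_add' := unbarOp_add }
  exact AddMonoidHomClass.continuous_of_bound φ 1 fun S => by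
    rw [one_mul]
    exact norm_unbarOp_le S

end ConjSpace

/-! ### Operator spaces and completely bounded maps -/

/-- An operator space: a norm-closed linear subspace `E ⊆ B(H)` for a complex Hilbert space `H`. -/
structure OperatorSpace where
  /-- the Hilbert space on which the elements of the operator space act -/
  H : Type u
  [normed : NormedAddCommGroup H]
  [hilbert : InnerProductSpace ℂ H]
  [complete : CompleteSpace H]
  /-- the closed subspace of `B(H)` -/
  carrier : Submodule ℂ (H →L[ℂ] H)
  isClosed_carrier : IsClosed (carrier : Set (H →L[ℂ] H))

namespace OperatorSpace

attribute [instance] OperatorSpace.normed OperatorSpace.hilbert OperatorSpace.complete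

instance : CoeSort OperatorSpace.{u} (Type u) := ⟨fun E => E.carrier⟩

/-- The operator on `ℓ²_n(H) = H ⊕ ⋯ ⊕ H` given by an `n × n` matrix of operators on `H`. -/
def matOp {H : Type*} [NormedAddCommGroup H] [InnerProductSpace ℂ H] {n : ℕ}
    (x : Matrix (Fin n) (Fin n) (H →L[ℂ] H)) :
    PiLp 2 (fun _ : Fin n => H) →L[ℂ] PiLp 2 (fun _ : Fin n => H) :=
  ((PiLp.continuousLinearEquiv 2 ℂ (fun _ : Fin n => H)).symm :
      (Fin n → H) →L[ℂ] PiLp 2 (fun _ : Fin n => H)) ∘L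
    ContinuousLinearMap.pi fun i => ∑ j, x i j ∘L PiLp.proj 2 (fun _ : Fin n => H) j

/-- The complex conjugate operator space `Ē = {x̄ : x ∈ E} ⊆ B(H̄)`. -/
def conj (E : OperatorSpace.{u}) : OperatorSpace.{u} where
  H := ConjSpace E.H
  carrier :=
    { carrier := {S | ConjSpace.unbarOp S ∈ E.carrier}
      add_mem' := fun {S T} hS hT => by
        change ConjSpace.unbarOp (S + T) ∈ E.carrier
        rw [ConjSpace.unbarOp_add]
        exact E.carrier.add_mem hS hT
      zero_mem' := E.carrier.zero_mem
      smul_mem' := fun c S hS => by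
        change ConjSpace.unbarOp (c • S) ∈ E.carrier
        rw [ConjSpace.unbarOp_smul]
        exact E.carrier.smul_mem _ hS }
  isClosed_carrier := E.isClosed_carrier.preimage ConjSpace.continuous_unbarOp

/-- The canonical antilinear bijection `x ↦ x̄` from `E` onto `Ē`. -/
def bar {E : OperatorSpace.{u}} (x : E) : E.conj := ⟨ConjSpace.barOp (H := E.H) x.1, x.2⟩

/-- The linear map `E ⊗ F → B(H ⊗ K)` for `E ⊆ B(H)` and `F ⊆ B(K)`, sending `x ⊗ y` to the
operator `ξ ⊗ η ↦ x ξ ⊗ y η`. Here `H ⊗ K` is the algebraic tensor product with its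
inner product `⟪a ⊗ b, c ⊗ d⟫ = ⟪a, c⟫ ⟪b, d⟫`, a dense subspace of the Hilbert tensor product. -/
def tensorOp (E F : OperatorSpace.{u}) :
    E ⊗[ℂ] F →ₗ[ℂ] (E.H ⊗[ℂ] F.H →L[ℂ] E.H ⊗[ℂ] F.H) :=
  TensorProduct.lift <| LinearMap.mk₂ ℂ
    (fun (x : E) (y : F) => TensorProduct.mapL (x : E.H →L[ℂ] E.H) (y : F.H →L[ℂ] F.H))
    (fun x x' y => TensorProduct.mapL_add_left (x : E.H →L[ℂ] E.H) x' (y : F.H →L[ℂ] F.H))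
    (fun c x y => TensorProduct.mapL_smul_left c (x : E.H →L[ℂ] E.H) (y : F.H →L[ℂ] F.H))
    (fun x y y' => TensorProduct.mapL_add_right (x : E.H →L[ℂ] E.H) (y : F.H →L[ℂ] F.H) y')
    (fun c x y => TensorProduct.mapL_smul_right c (x : E.H →L[ℂ] E.H) (y : F.H →L[ℂ] F.H))

/-- The norm of the minimal (spatial) tensor product `E ⊗_min F ⊆ B(H ⊗₂ K)`. An operator on the
Hilbert tensor product has the same norm as its restriction to the dense algebraic one. -/
def minNorm {E F : OperatorSpace.{u}} (t : E ⊗[ℂ] F) : ℝ≥0 := ‖tensorOp E F t‖₊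

end OperatorSpace

/-- A choice of a size for every square matrix over `V`; it is given to operator spaces and
to `OH(I)` below. -/
class MatrixNormed (V : Type*) where
  /-- the norm on `M_n(V)` -/
  matNorm : ∀ {n : ℕ}, Matrix (Fin n) (Fin n) V → ℝ≥0

open MatrixNormed (matNorm)

/-- The matrix norms of an operator space: `M_n(E) ⊆ M_n(B(H)) = B(ℓ²_n(H))`. -/
instance OperatorSpace.instMatrixNormed (E : OperatorSpace.{u}) : MatrixNormed E where
  matNorm x := ‖OperatorSpace.matOp (x.map fun e => (e : E.H →L[ℂ] E.H))‖₊

/-- The Banach space `ℓ²(I)` underlying Pisier's operator Hilbert space `OH(I)`. -/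
abbrev OH (I : Type u) : Type u := lp (fun _ : I => ℂ) 2

/-- For `X = ∑ᵢ aᵢ ⊗ Tᵢ ∈ M_n(ℓ²(I))`, with `(Tᵢ)` the canonical basis and `aᵢ ∈ M_n(ℂ)`, the
`n² × n²` matrix `∑ᵢ aᵢ ⊗ āᵢ`, whose entry at `((k, k'), (l, l'))` is
`∑ᵢ aᵢ(k, l) conj (aᵢ(k', l')) = ⟪X k' l', X k l⟫`. -/
def ohGram {I : Type u} {n : ℕ} (X : Matrix (Fin n) (Fin n) (OH I)) :
    Matrix (Fin n × Fin n) (Fin n × Fin n) ℂ :=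
  Matrix.of fun p q => inner ℂ (X p.2 q.2) (X p.1 q.1)

theorem ohGram_apply {I : Type u} {n : ℕ} (X : Matrix (Fin n) (Fin n) (OH I))
    (p q : Fin n × Fin n) :
    ohGram X p q = ∑' i, X p.1 q.1 i * (starRingEnd ℂ) (X p.2 q.2 i) := by
  simp [ohGram, lp.inner_eq_tsum]

/-- The operator space structure of `OH(I)`:
`‖∑ᵢ aᵢ ⊗ Tᵢ‖ = ‖∑ᵢ aᵢ ⊗ āᵢ‖ ^ (1/2)`, with the operator norm of `n² × n²` matrices. -/
instance OH.instMatrixNormed (I : Type u) : MatrixNormed (OH I) where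
  matNorm X := NNReal.sqrt
    ‖Matrix.toEuclideanCLM (n := Fin _ × Fin _) (𝕜 := ℂ) (ohGram X)‖₊

/-- The completely bounded norm `‖T‖_cb = sup_n ‖id ⊗ T : M_n(V) → M_n(W)‖ ∈ [0, ∞]`. -/
def cbNorm {V W : Type*} [AddCommGroup V] [Module ℂ V] [MatrixNormed V]
    [AddCommGroup W] [Module ℂ W] [MatrixNormed W] (T : V →ₗ[ℂ] W) : ℝ≥0∞ :=
  ⨆ (n : ℕ) (x : Matrix (Fin n) (Fin n) V) (_ : matNorm x ≤ 1), (matNorm (x.map T) : ℝ≥0∞)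

/-- `T` is completely isometric: all `id ⊗ T : M_n(V) → M_n(W)` preserve norms. -/
def IsCompleteIsometry {V W : Type*} [AddCommGroup V] [Module ℂ V] [MatrixNormed V]
    [AddCommGroup W] [Module ℂ W] [MatrixNormed W] (T : V →ₗ[ℂ] W) : Prop :=
  ∀ (n : ℕ) (x : Matrix (Fin n) (Fin n) V), matNorm (x.map T) = matNorm x

/-! ### The `(2,oh)`-summing norm, and the ideal norm `δ` -/

/-- The `(2,oh)`-summing norm `π_{2,oh}(w) ∈ [0, ∞]` of a linear map from an operator space to a
normed space: the infimum of the constants `C` such that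
`∑ᵢ ‖w xᵢ‖² ≤ C² ‖∑ᵢ xᵢ ⊗ x̄ᵢ‖_min` for all finite sequences `(xᵢ)` in `E`
(`∞` if there is no such constant). -/
def pi2oh {E : OperatorSpace.{u}} {Y : Type*} [NormedAddCommGroup Y] [NormedSpace ℂ Y]
    (w : E →ₗ[ℂ] Y) : ℝ≥0∞ :=
  ⨅ (C : ℝ≥0) (_ : ∀ (n : ℕ) (x : Fin n → E),
    ∑ i, ‖w (x i)‖₊ ^ 2 ≤
      C ^ 2 * OperatorSpace.minNorm (∑ i, x i ⊗ₜ[ℂ] OperatorSpace.bar (x i))), (C : ℝ≥0∞)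

/-- `δ(T) = inf ‖v‖_cb π_{2,oh}(w)` over all factorizations `T = v w` through some `OH(I)`. -/
def delta (E F : OperatorSpace.{u}) (T : E →ₗ[ℂ] F) : ℝ≥0∞ :=
  ⨅ (I : Type u) (w : E →ₗ[ℂ] OH I) (v : OH I →ₗ[ℂ] F) (_ : v ∘ₗ w = T), cbNorm v * pi2oh w

/-- An operator ideal norm: an assignment `T ↦ α(T) ∈ [0, ∞]` for all linear maps between operator
spaces which is a norm where it is finite, dominates the completely bounded norm, and has the
ideal property. -/
structure IsOperatorIdealNorm
    (α : ∀ E F : OperatorSpace.{u}, (E →ₗ[ℂ] F) → ℝ≥0∞) : Prop where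
  eq_zero_iff : ∀ (E F : OperatorSpace.{u}) (T : E →ₗ[ℂ] F), α E F T = 0 ↔ T = 0
  smul : ∀ (E F : OperatorSpace.{u}) (c : ℂ) (T : E →ₗ[ℂ] F), α E F (c • T) = ‖c‖ₑ * α E F T
  add_le : ∀ (E F : OperatorSpace.{u}) (S T : E →ₗ[ℂ] F), α E F (S + T) ≤ α E F S + α E F T
  cbNorm_le : ∀ (E F : OperatorSpace.{u}) (T : E →ₗ[ℂ] F), cbNorm T ≤ α E F T
  ideal : ∀ (D E F G : OperatorSpace.{u}) (a : D →ₗ[ℂ] E) (T : E →ₗ[ℂ] F) (b : F →ₗ[ℂ] G),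
    cbNorm a < ∞ → cbNorm b < ∞ → α D G (b ∘ₗ T ∘ₗ a) ≤ cbNorm b * α E F T * cbNorm a

/-- `α` is 1-injective: `α(T) = α(i T)` for every completely isometric inclusion `i`. -/
def IsOneInjective (α : ∀ E F : OperatorSpace.{u}, (E →ₗ[ℂ] F) → ℝ≥0∞) : Prop :=
  ∀ (E F G : OperatorSpace.{u}) (T : E →ₗ[ℂ] F) (i : F →ₗ[ℂ] G),
    IsCompleteIsometry i → α E G (i ∘ₗ T) = α E F T

end

noncomputable section

open MatrixNormed (matNorm)

open scoped InnerProductSpace ComplexConjugate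

/-! ### Square-summable families, Bessel families and the Schur test -/

/-! The norms that occur are all governed by one positive form. For operators `xᵢ` put `Φ(f, u) =
(⟪f, xᵢ u⟫)ᵢ`. The norm of `∑ xᵢ ⊗ x̄ᵢ` is the least `c ≥ 0` with `∑ s p * t q * ‖Φ (f p) (u q)‖² ≤
c * ‖s‖₂ * ‖t‖₂` for all Bessel families `f`, `u` and nonnegative weights `s`, `t`; this is
`HaagerupBound`. Such a `c` is at most the norm because the left side is a matrix coefficient on the
vectors `∑ s p • f p ⊗ conj (f p)`; conversely, Schmidt decompositions and Cauchy–Schwarz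
(`HaagerupBound.norm_sum_inner_le`) bound every coefficient. In the same way Haagerup bounds
describe the squared matrix norms of `OH(I)` and the squared cb norm of a map out of `OH(I)`.

Four consequences give the proposition. A `(2, oh)`-summing map into `OH(I)` is completely bounded
with `cbNorm w ≤ pi2oh w` (`cbNorm_le_pi2oh`), so `δ` dominates the cb norm, and definiteness
follows. The map `a ⊗ ā` increases the norm of `∑ xᵢ ⊗ x̄ᵢ` by a factor at most `‖a‖_cb²`
(`norm_doubleOp_map_le`), which gives the ideal property. Haagerup bounds add, so both squared
constants add when factorizations are joined through the Hilbert sum of `OH(I)` and `OH(J)`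
(`cbNorm_add_comp_le`); after balancing the two factors this is the triangle inequality. Finally,
closed subspaces of `OH(I)` are again of the form `OH(B)`, completely isometrically. Hence a
factorization of `i T` can be cut down to the closure of the range of `w`, where `v` takes values in
the closed range of `i`; this is 1-injectivity. -/

/-- The `ℓ²` norm of a finite family. -/
def l2 {ι V : Type*} [Fintype ι] [Norm V] (g : ι → V) : ℝ := √(∑ i, ‖g i‖ ^ 2)

section l2

variable {ι κ V : Type*} [Fintype ι] [Fintype κ]

theorem l2_nonneg [Norm V] (g : ι → V) : 0 ≤ l2 g := Real.sqrt_nonneg _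

theorem l2_sq [SeminormedAddCommGroup V] (g : ι → V) : l2 g ^ 2 = ∑ i, ‖g i‖ ^ 2 :=
  Real.sq_sqrt (by positivity)

theorem sum_mul_le_l2_mul_l2 (a b : ι → ℝ) : ∑ i, a i * b i ≤ l2 a * l2 b := by
  simpa [l2] using Real.sum_mul_le_sqrt_mul_sqrt Finset.univ a b

/-- The Cauchy–Schwarz inequality with weights `s p * t q`. -/
theorem weighted_cauchy_schwarz {s : ι → ℝ} {t : κ → ℝ} (hs : ∀ p, 0 ≤ s p) (ht : ∀ q, 0 ≤ t q)
    (a b : ι → κ → ℝ) :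
    ∑ p, ∑ q, s p * t q * (a p q * b p q) ≤
      √(∑ p, ∑ q, s p * t q * a p q ^ 2) * √(∑ p, ∑ q, s p * t q * b p q ^ 2) := by
  have h := Real.sum_mul_le_sqrt_mul_sqrt (Finset.univ : Finset (ι × κ))
    (fun z => √(s z.1 * t z.2) * a z.1 z.2) (fun z => √(s z.1 * t z.2) * b z.1 z.2)
  have hst : ∀ p q, √(s p * t q) ^ 2 = s p * t q := fun p q =>
    Real.sq_sqrt (mul_nonneg (hs p) (ht q))
  simp only [Fintype.sum_prod_type, mul_pow, hst] at h
  refine le_trans (le_of_eq ?_) h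
  refine Finset.sum_congr rfl fun p _ => Finset.sum_congr rfl fun q _ => ?_
  linear_combination (-(a p q * b p q)) * hst p q

/-- The Schur test for a nonnegative kernel. -/
theorem schur_test (s : ι → ℝ) (t : κ → ℝ)
    {m : ι → κ → ℝ} (hm : ∀ p q, 0 ≤ m p q) {c : ℝ} (hr : ∀ p, ∑ q, m p q ≤ c)
    (hc : ∀ q, ∑ p, m p q ≤ c) :
    ∑ p, ∑ q, s p * t q * m p q ≤ |c| * (l2 s * l2 t) := by
  -- Cauchy–Schwarz with the kernel split as `√m * √m`. The row and column bounds force `0 ≤ c`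
  -- unless both index types are empty; `|c|` covers that case.
  have h := Real.sum_mul_le_sqrt_mul_sqrt (Finset.univ : Finset (ι × κ))
    (fun z => s z.1 * √(m z.1 z.2)) (fun z => t z.2 * √(m z.1 z.2))
  have hst : ∀ p q, √(m p q) ^ 2 = m p q := fun p q => Real.sq_sqrt (hm p q)
  simp only [Fintype.sum_prod_type, mul_pow, hst] at h
  have h1 : ∑ p, ∑ q, s p ^ 2 * m p q ≤ |c| * l2 s ^ 2 := by
    rw [l2_sq, Finset.mul_sum]
    refine Finset.sum_le_sum fun p _ => ?_
    rw [← Finset.mul_sum, mul_comm]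
    simp only [Real.norm_eq_abs, sq_abs]
    exact mul_le_mul_of_nonneg_right ((hr p).trans (le_abs_self c)) (sq_nonneg _)
  have h2 : ∑ p, ∑ q, t q ^ 2 * m p q ≤ |c| * l2 t ^ 2 := by
    rw [l2_sq, Finset.mul_sum, Finset.sum_comm]
    refine Finset.sum_le_sum fun p _ => ?_
    rw [← Finset.mul_sum, mul_comm]
    simp only [Real.norm_eq_abs, sq_abs]
    exact mul_le_mul_of_nonneg_right ((hc p).trans (le_abs_self c)) (sq_nonneg _)
  calc ∑ p, ∑ q, s p * t q * m p q
      = ∑ p, ∑ q, s p * √(m p q) * (t q * √(m p q)) := by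
        refine Finset.sum_congr rfl fun p _ => Finset.sum_congr rfl fun q _ => ?_
        conv_lhs => rw [← hst p q]
        ring
    _ ≤ _ := h
    _ ≤ √(|c| * l2 s ^ 2) * √(|c| * l2 t ^ 2) := by gcongr
    _ = |c| * (l2 s * l2 t) := by
        rw [Real.sqrt_mul (abs_nonneg c), Real.sqrt_mul (abs_nonneg c),
          Real.sqrt_sq (l2_nonneg s), Real.sqrt_sq (l2_nonneg t)]
        linear_combination (l2 s * l2 t) * Real.mul_self_sqrt (abs_nonneg c)

end l2

theorem sum_comm_four {α β γ δ M : Type*} [Fintype α] [Fintype β] [Fintype γ] [Fintype δ]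
    [AddCommMonoid M] (F : α → β → γ → δ → M) :
    ∑ a, ∑ b, ∑ c, ∑ d, F a b c d = ∑ c, ∑ d, ∑ a, ∑ b, F a b c d := by
  simpa only [Fintype.sum_prod_type] using
    Finset.sum_comm (s := (Finset.univ : Finset (α × β))) (t := (Finset.univ : Finset (γ × δ)))
      (f := fun x y => F x.1 x.2 y.1 y.2)

/-- A finite family satisfying Bessel's inequality. -/
def IsBessel {ι H : Type*} [Fintype ι] [NormedAddCommGroup H] [InnerProductSpace ℂ H]
    (f : ι → H) : Prop :=
  ∀ h : H, ∑ i, ‖⟪f i, h⟫_ℂ‖ ^ 2 ≤ ‖h‖ ^ 2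

section Bessel

variable {ι κ H : Type*} [Fintype ι] [Fintype κ] [NormedAddCommGroup H] [InnerProductSpace ℂ H]

theorem Orthonormal.isBessel {f : ι → H} (hf : Orthonormal ℂ f) : IsBessel f := fun h =>
  hf.sum_inner_products_le h

theorem IsBessel.norm_sum_le {f : ι → H} (hf : IsBessel f) (c : ι → ℂ) :
    ‖∑ i, c i • f i‖ ≤ l2 c := by
  set y := ∑ i, c i • f i with hy
  rcases eq_or_lt_of_le (norm_nonneg y) with h0 | h0
  · rw [← h0]; exact l2_nonneg c
  have h1 : ‖y‖ ^ 2 ≤ l2 c * ‖y‖ := by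
    have e : ‖y‖ ^ 2 = ‖⟪y, y⟫_ℂ‖ := by
      rw [inner_self_eq_norm_sq_to_K]; simp
    rw [e]
    have e2 : ⟪y, y⟫_ℂ = ∑ i, ⟪c i • f i, y⟫_ℂ := by
      rw [← sum_inner]
    rw [e2]
    refine (_root_.norm_sum_le _ _).trans ?_
    simp only [inner_smul_left, norm_mul, RCLike.norm_conj]
    refine (sum_mul_le_l2_mul_l2 _ _).trans ?_
    have e1 : l2 (fun i => ‖c i‖) = l2 c := by simp [l2]
    rw [e1]
    gcongr
    · exact l2_nonneg c
    · refine Real.sqrt_le_iff.2 ⟨norm_nonneg _, ?_⟩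
      simpa using hf y
  nlinarith

theorem IsBessel.norm_le_one {f : ι → H} (hf : IsBessel f) (i : ι) : ‖f i‖ ≤ 1 := by
  classical
  have := hf.norm_sum_le (Pi.single i 1)
  simpa [l2, Pi.single_apply, Finset.sum_ite_eq, apply_ite] using this

theorem IsBessel.sum_inner_sq_le {f : ι → H} (hf : IsBessel f) (h : H) :
    ∑ i, ‖⟪h, f i⟫_ℂ‖ ^ 2 ≤ ‖h‖ ^ 2 := by
  simpa only [norm_inner_symm] using hf h

/-- Contractive combinations of a Bessel family are Bessel. -/
theorem IsBessel.combine {f : ι → H} (hf : IsBessel f) {e : κ → EuclideanSpace ℂ ι}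
    (he : IsBessel e) : IsBessel fun a => ∑ p, e a p • f p := by
  intro h
  let z : EuclideanSpace ℂ ι := WithLp.toLp 2 fun p => ⟪f p, h⟫_ℂ
  have h1 := he z
  have h2 : ‖z‖ ^ 2 ≤ ‖h‖ ^ 2 := by
    rw [EuclideanSpace.norm_sq_eq]; exact hf h
  refine le_trans (le_of_eq ?_) (h1.trans h2)
  refine Finset.sum_congr rfl fun a _ => ?_
  simp [z, PiLp.inner_apply]

theorem IsBessel.conj {e : κ → EuclideanSpace ℂ ι} (he : IsBessel e) :
    IsBessel fun a => (WithLp.toLp 2 fun p => conj (e a p) : EuclideanSpace ℂ ι) := by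
  intro h
  have h1 := he (WithLp.toLp 2 fun p => conj (h p))
  have h2 : ‖(WithLp.toLp 2 fun p => conj (h p) : EuclideanSpace ℂ ι)‖ ^ 2 = ‖h‖ ^ 2 := by
    simp [EuclideanSpace.norm_sq_eq]
  rw [h2] at h1
  refine le_trans (le_of_eq ?_) h1
  refine Finset.sum_congr rfl fun a _ => ?_
  rw [← RCLike.norm_conj]
  simp [PiLp.inner_apply]

/-- The Gram kernel of a Bessel family is contractive after taking squared moduli. -/
theorem IsBessel.sum_gram_sq_le {f : ι → H} (hf : IsBessel f) (s : ι → ℝ) :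
    ∑ p, ∑ q, s p * s q * ‖⟪f p, f q⟫_ℂ‖ ^ 2 ≤ l2 s ^ 2 := by
  have h1 : ∀ p, ‖f p‖ ^ 2 ≤ 1 := fun p => pow_le_one₀ (norm_nonneg _) (hf.norm_le_one p)
  have := schur_test s s (m := fun p q => ‖⟪f p, f q⟫_ℂ‖ ^ 2) (fun _ _ => sq_nonneg _) (c := 1)
    (fun p => (hf.sum_inner_sq_le (f p)).trans (h1 p)) (fun q => (hf (f q)).trans (h1 q))
  simpa [sq] using this

/-- A Schmidt decomposition of a finite family of vectors. -/
theorem exists_schmidt [DecidableEq ι] (g : ι → H) :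
    ∃ (s : ι → ℝ) (e : ι → EuclideanSpace ℂ ι) (f : ι → H), (∀ r, 0 ≤ s r) ∧ l2 s = l2 g ∧
      IsBessel e ∧ IsBessel f ∧ ∀ k, g k = ∑ r, ((s r : ℂ) * conj (e r k)) • f r := by
  have hA := Matrix.isHermitian_gram ℂ g
  let e := hA.eigenvectorBasis
  -- Eigenvectors of the Gram matrix yield combinations of `g` that are mutually orthogonal, with
  -- the eigenvalues as squared norms.
  let F : ι → H := fun r => ∑ k, e r k • g k
  have hFF : ∀ r r', ⟪F r, F r'⟫_ℂ = if r = r' then (hA.eigenvalues r' : ℂ) else 0 := by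
    intro r r'
    have h1 := Matrix.star_dotProduct_gram_mulVec (𝕜 := ℂ) g (e r) (e r')
    rw [hA.mulVec_eigenvectorBasis] at h1
    have h2 : ⟪e r, e r'⟫_ℂ = if r = r' then 1 else 0 :=
      orthonormal_iff_ite.1 e.orthonormal r r'
    rw [EuclideanSpace.inner_eq_star_dotProduct] at h2
    rw [dotProduct_smul, dotProduct_comm, h2] at h1
    change _ = ⟪F r, F r'⟫_ℂ at h1
    rw [← h1]
    split_ifs <;> simp
  have hsum : ∀ k, g k = ∑ r, conj (e r k) • F r := by
    intro k
    have h3 : ∀ l, ∑ r, conj (e r k) * e r l = if k = l then 1 else 0 := by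
      intro l
      have := e.sum_inner_mul_inner (EuclideanSpace.single l 1) (EuclideanSpace.single k (1 : ℂ))
      have h4 : ∀ r, ⟪EuclideanSpace.single l 1, e r⟫_ℂ * ⟪e r, EuclideanSpace.single k (1 : ℂ)⟫_ℂ
          = conj (e r k) * e r l := by
        intro r
        simp [EuclideanSpace.inner_single_left, EuclideanSpace.inner_single_right, mul_comm]
      simp only [h4] at this
      rw [this]
      simp [EuclideanSpace.inner_single_left, eq_comm]
    simp only [F, Finset.smul_sum, smul_smul]
    rw [Finset.sum_comm]
    simp only [← Finset.sum_smul, h3]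
    simp
  have hnorm : ∑ r, ‖F r‖ ^ 2 = ∑ k, ‖g k‖ ^ 2 := by
    have h5 : ∀ r, ‖F r‖ ^ 2 = hA.eigenvalues r := by
      intro r
      have := hFF r r
      rw [inner_self_eq_norm_sq_to_K, if_pos rfl] at this
      exact Complex.ofReal_injective (by simpa using this)
    have h6 : (Matrix.gram ℂ g).trace = ∑ k, ((‖g k‖ ^ 2 : ℝ) : ℂ) := by
      refine Finset.sum_congr rfl fun k _ => ?_
      simp [Matrix.gram_apply, inner_self_eq_norm_sq_to_K]
    rw [hA.trace_eq_sum_eigenvalues] at h6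
    simp only [h5]
    exact Complex.ofReal_injective (by simpa using h6)
  have hF0 : ∀ r r', r ≠ r' → ⟪F r, F r'⟫_ℂ = 0 := fun r r' h => by rw [hFF, if_neg h]
  -- Since `0⁻¹ = 0`, a vanishing `F r` is normalized to zero, so the normalized family is Bessel
  -- but not necessarily orthonormal.
  refine ⟨fun r => ‖F r‖, e, fun r => ((‖F r‖⁻¹ : ℝ) : ℂ) • F r, fun r => norm_nonneg _, ?_,
    e.orthonormal.isBessel, ?_, ?_⟩
  · simp [l2, hnorm]
  · intro h
    have hon : Orthonormal ℂ fun r : {r // F r ≠ 0} => ((‖F r‖⁻¹ : ℝ) : ℂ) • F r := by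
      refine ⟨fun r => ?_, fun r r' hr => ?_⟩
      · have := norm_ne_zero_iff.2 r.2
        simp [norm_smul, this]
      · dsimp only
        rw [inner_smul_left, inner_smul_right, hF0 _ _ fun h => hr (Subtype.ext h)]
        simp
    classical
    refine le_trans (le_of_eq ?_) (hon.isBessel h)
    rw [← Finset.sum_filter_of_ne (p := fun r => F r ≠ 0), ← Finset.sum_subtype_eq_sum_filter]
    · simp
    · intro r _ hr h0
      simp [h0] at hr
  · intro k
    rw [hsum k]
    refine Finset.sum_congr rfl fun r _ => ?_
    rw [smul_smul]
    rcases eq_or_ne (F r) 0 with h0 | h0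
    · simp [h0]
    · have : (‖F r‖ : ℂ) ≠ 0 := by exact_mod_cast norm_ne_zero_iff.2 h0
      congr 1
      push_cast
      field_simp

end Bessel

/-! ### The Haagerup bound of a sesquilinear map -/

section Haagerup

variable {H K H' K' Y : Type*} [NormedAddCommGroup H] [InnerProductSpace ℂ H]
  [NormedAddCommGroup K] [InnerProductSpace ℂ K]
  [NormedAddCommGroup H'] [InnerProductSpace ℂ H']
  [NormedAddCommGroup K'] [InnerProductSpace ℂ K']
  [NormedAddCommGroup Y] [InnerProductSpace ℂ Y]

/-- The sesquilinear map `Φ` has Haagerup bound `c`: the positive form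
`(s, t) ↦ ∑ s p * t q * ‖Φ (f p) (u q)‖ ^ 2` has norm at most `c` for all Bessel families. -/
def HaagerupBound (Φ : H →ₗ⋆[ℂ] K →ₗ[ℂ] Y) (c : ℝ) : Prop :=
  ∀ ⦃ι κ : Type⦄ [Fintype ι] [Fintype κ] (f : ι → H) (u : κ → K) (s : ι → ℝ) (t : κ → ℝ),
    IsBessel f → IsBessel u → (∀ p, 0 ≤ s p) → (∀ q, 0 ≤ t q) →
      ∑ p, ∑ q, s p * t q * ‖Φ (f p) (u q)‖ ^ 2 ≤ c * (l2 s * l2 t)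

/-- Haagerup's Cauchy–Schwarz inequality. -/
theorem HaagerupBound.norm_sum_inner_le {Φ : H →ₗ⋆[ℂ] K →ₗ[ℂ] Y} {Ψ : H' →ₗ⋆[ℂ] K' →ₗ[ℂ] Y}
    {c c' : ℝ} (hc : 0 ≤ c) (hc' : 0 ≤ c') (hΦ : HaagerupBound Φ c) (hΨ : HaagerupBound Ψ c')
    {ι κ : Type} [Fintype ι] [Fintype κ] {k : ι → H'} {m : κ → K'} (hk : IsBessel k)
    (hm : IsBessel m) (g : ι → H) (h : κ → K) :
    ‖∑ r, ∑ r', ⟪Ψ (k r) (m r'), Φ (g r) (h r')⟫_ℂ‖ ≤ √c' * √c * (l2 g * l2 h) := by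
  classical
  obtain ⟨s, e, f, hs, hsg, he, hf, hg⟩ := exists_schmidt g
  obtain ⟨t, d, u, ht, hth, hd, hu, hh⟩ := exists_schmidt h
  -- The Schmidt coefficients of `g` and `h` are moved to the arguments of `Ψ`, which stay Bessel.
  -- What remains is a sum with nonnegative weights `s a * t b`, and both factors of Cauchy–Schwarz
  -- are controlled with these same weights.
  let k' : ι → H' := fun a => ∑ r, e a r • k r
  let m' : κ → K' := fun b => ∑ r', d b r' • m r'
  have hk' : IsBessel k' := hk.combine he
  have hm' : IsBessel m' := hm.combine hd
  have key : ∑ r, ∑ r', ⟪Ψ (k r) (m r'), Φ (g r) (h r')⟫_ℂ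
      = ∑ a, ∑ b, ((s a * t b : ℝ) : ℂ) * ⟪Ψ (k' a) (m' b), Φ (f a) (u b)⟫_ℂ := by
    have h1 : ∀ r r', ⟪Ψ (k r) (m r'), Φ (g r) (h r')⟫_ℂ = ∑ a, ∑ b,
        ((s a * t b : ℝ) : ℂ) * (e a r * conj (d b r') * ⟪Ψ (k r) (m r'), Φ (f a) (u b)⟫_ℂ) := by
      intro r r'
      rw [hg r, hh r']
      simp only [map_sum, LinearMap.map_smulₛₗ, LinearMap.sum_apply, LinearMap.smul_apply,
        inner_sum, inner_smul_right, map_mul, Complex.conj_conj, Complex.conj_ofReal,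
        RingHom.id_apply, Finset.smul_sum]
      rw [Finset.sum_comm]
      refine Finset.sum_congr rfl fun a _ => Finset.sum_congr rfl fun b _ => ?_
      push_cast
      ring
    have h2 : ∀ a b, ⟪Ψ (k' a) (m' b), Φ (f a) (u b)⟫_ℂ
        = ∑ r, ∑ r', e a r * conj (d b r') * ⟪Ψ (k r) (m r'), Φ (f a) (u b)⟫_ℂ := by
      intro a b
      simp only [k', m', map_sum, LinearMap.map_smulₛₗ, LinearMap.sum_apply, LinearMap.smul_apply,
        sum_inner, inner_smul_left, Complex.conj_conj, RingHom.id_apply, Finset.mul_sum]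
      rw [Finset.sum_comm]
      refine Finset.sum_congr rfl fun r _ => Finset.sum_congr rfl fun r' _ => ?_
      ring
    simp only [h1, h2, Finset.mul_sum]
    exact sum_comm_four _
  rw [key]
  calc ‖∑ a, ∑ b, ((s a * t b : ℝ) : ℂ) * ⟪Ψ (k' a) (m' b), Φ (f a) (u b)⟫_ℂ‖
      ≤ ∑ a, ∑ b, s a * t b * (‖Ψ (k' a) (m' b)‖ * ‖Φ (f a) (u b)‖) := by
        refine (norm_sum_le _ _).trans (Finset.sum_le_sum fun a _ => ?_)
        refine (norm_sum_le _ _).trans (Finset.sum_le_sum fun b _ => ?_)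
        rw [norm_mul, Complex.norm_real, Real.norm_of_nonneg (mul_nonneg (hs a) (ht b))]
        exact mul_le_mul_of_nonneg_left (norm_inner_le_norm _ _) (mul_nonneg (hs a) (ht b))
    _ ≤ √(c' * (l2 s * l2 t)) * √(c * (l2 s * l2 t)) :=
        (weighted_cauchy_schwarz hs ht _ _).trans <| by
          gcongr
          · exact hΨ k' m' s t hk' hm' hs ht
          · exact hΦ f u s t hf hu hs ht
    _ = √c' * √c * (l2 g * l2 h) := by
        have h0 : 0 ≤ l2 g * l2 h := mul_nonneg (l2_nonneg _) (l2_nonneg _)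
        rw [hsg, hth, Real.sqrt_mul hc', Real.sqrt_mul hc]
        linear_combination (√c' * √c) * Real.mul_self_sqrt h0

end Haagerup

/-! ### Norms of operators through matrix coefficients -/

section Coefficients

variable {H K : Type*} [NormedAddCommGroup H] [InnerProductSpace ℂ H]
  [NormedAddCommGroup K] [InnerProductSpace ℂ K]

theorem opNorm_le_of_norm_inner_le (A : H →L[ℂ] H) {c : ℝ} (hc : 0 ≤ c)
    (h : ∀ x y, ‖⟪x, A y⟫_ℂ‖ ≤ c * (‖x‖ * ‖y‖)) : ‖A‖ ≤ c := by
  refine A.opNorm_le_bound hc fun y => ?_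
  have h1 := h (A y) y
  rw [inner_self_eq_norm_sq_to_K] at h1
  simp only [Complex.coe_algebraMap, norm_pow, Complex.norm_real, norm_norm] at h1
  rcases eq_or_lt_of_le (norm_nonneg (A y)) with h0 | h0
  · rw [← h0]; positivity
  · nlinarith

theorem norm_inner_apply_le (A : H →L[ℂ] H) (x y : H) : ‖⟪x, A y⟫_ℂ‖ ≤ ‖A‖ * (‖x‖ * ‖y‖) :=
  (norm_inner_le_norm _ _).trans <| by
    calc ‖x‖ * ‖A y‖ ≤ ‖x‖ * (‖A‖ * ‖y‖) := by gcongr; exact A.le_opNorm y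
      _ = _ := by ring

theorem norm_sum_tmul_of_orthonormal {ι : Type*} [Fintype ι] {k : ι → K} (hk : Orthonormal ℂ k)
    (g : ι → H) : ‖∑ r, g r ⊗ₜ[ℂ] k r‖ = l2 g := by
  classical
  rw [← sq_eq_sq₀ (norm_nonneg _) (l2_nonneg _), l2_sq]
  have h : ⟪∑ r, g r ⊗ₜ[ℂ] k r, ∑ r, g r ⊗ₜ[ℂ] k r⟫_ℂ = ∑ r, ((‖g r‖ ^ 2 : ℝ) : ℂ) := by
    simp only [sum_inner, inner_sum, TensorProduct.inner_tmul, orthonormal_iff_ite.1 hk]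
    simp [inner_self_eq_norm_sq_to_K]
  have h' := (inner_self_eq_norm_sq_to_K (𝕜 := ℂ) (E := H ⊗[ℂ] K) _).symm.trans h
  exact Complex.ofReal_injective (by simpa using h')

/-- Every algebraic tensor is a finite sum along an orthonormal family in the second variable. -/
theorem exists_eq_sum_tmul_orthonormal (z : H ⊗[ℂ] K) :
    ∃ (n : ℕ) (k : Fin n → K) (g : Fin n → H), Orthonormal ℂ k ∧ z = ∑ r, g r ⊗ₜ[ℂ] k r := by
  obtain ⟨S, rfl⟩ := TensorProduct.exists_finset z
  let B : Submodule ℂ K := Submodule.span ℂ (Prod.snd '' (S : Set (H × K)))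
  have hB : FiniteDimensional ℂ B :=
    FiniteDimensional.span_of_finite ℂ (S.finite_toSet.image Prod.snd)
  let b := stdOrthonormalBasis ℂ B
  refine ⟨_, fun r => (b r : K), fun r => ∑ i ∈ S, ⟪(b r : K), i.2⟫_ℂ • i.1,
    b.orthonormal.comp_linearIsometry B.subtypeₗᵢ, ?_⟩
  simp only [TensorProduct.sum_tmul]
  rw [Finset.sum_comm]
  refine Finset.sum_congr rfl fun i hi => ?_
  have hi' : i.2 ∈ B := Submodule.subset_span ⟨i, hi, rfl⟩
  have := congrArg (Submodule.subtype B) (b.sum_repr' ⟨i.2, hi'⟩)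
  simp only [map_sum, map_smul, Submodule.subtype_apply] at this
  conv_lhs => rw [← this]
  rw [TensorProduct.tmul_sum]
  refine Finset.sum_congr rfl fun r _ => ?_
  rw [TensorProduct.tmul_smul, TensorProduct.smul_tmul']
  rfl

/-- The sesquilinear map `(f, u) ↦ (⟪f, xᵢ u⟫)ᵢ` of a finite family of operators. -/
def coeffForm {ι : Type*} [Fintype ι] (x : ι → H →L[ℂ] H) :
    H →ₗ⋆[ℂ] H →ₗ[ℂ] EuclideanSpace ℂ ι :=
  LinearMap.mk₂'ₛₗ (starRingEnd ℂ) (RingHom.id ℂ)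
    (fun f u => WithLp.toLp 2 fun i => ⟪f, x i u⟫_ℂ)
    (fun f f' u => by ext i; simp)
    (fun c f u => by ext i; simp [mul_comm])
    (fun f u u' => by ext i; simp)
    (fun c f u => by ext i; simp)

theorem coeffForm_apply {ι : Type*} [Fintype ι] (x : ι → H →L[ℂ] H) (f u : H) (i : ι) :
    coeffForm x f u i = ⟪f, x i u⟫_ℂ := rfl

/-- The operator `∑ xᵢ ⊗ x̄ᵢ`. -/
def doubleOp {ι : Type*} [Fintype ι] (x : ι → H →L[ℂ] H) :
    H ⊗[ℂ] ConjSpace H →L[ℂ] H ⊗[ℂ] ConjSpace H :=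
  ∑ i, TensorProduct.mapL (x i) (ConjSpace.barOp (x i))

/-- This identity links the tensor norm to `HaagerupBound`: conjugation in the second leg turns the
product of two scalar coefficients into one term of an inner product. -/
theorem inner_tmul_doubleOp {ι : Type*} [Fintype ι] (x : ι → H →L[ℂ] H) (g h : H)
    (k m : ConjSpace H) :
    ⟪g ⊗ₜ[ℂ] k, doubleOp x (h ⊗ₜ[ℂ] m)⟫_ℂ =
      ⟪coeffForm x (ConjSpace.unbar k) (ConjSpace.unbar m), coeffForm x g h⟫_ℂ := by
  simp only [doubleOp, _root_.sum_apply, TensorProduct.mapL_tmul, inner_sum,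
    TensorProduct.inner_tmul, PiLp.inner_apply]
  refine Finset.sum_congr rfl fun i _ => ?_
  rw [coeffForm_apply, coeffForm_apply, RCLike.inner_apply, inner_conj_symm]
  rfl

/-- As `b` conjugates inner products, the squared norm is the sum of `s p * s q * ‖⟪f p, f q⟫‖²`, to
which the Schur test for the Gram kernel applies. -/
theorem IsBessel.norm_sum_tmul_le {ι : Type*} [Fintype ι] {f : ι → H} (hf : IsBessel f)
    {b : H → K} (hb : ∀ x y, ⟪b x, b y⟫_ℂ = ⟪y, x⟫_ℂ) (s : ι → ℝ) :
    ‖∑ p, ((s p : ℂ) • f p) ⊗ₜ[ℂ] b (f p)‖ ≤ l2 s := by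
  refine abs_le_of_sq_le_sq' ?_ (l2_nonneg s) |>.2
  refine le_trans (le_of_eq ?_) (hf.sum_gram_sq_le s)
  have h : ⟪∑ p, ((s p : ℂ) • f p) ⊗ₜ[ℂ] b (f p), ∑ p, ((s p : ℂ) • f p) ⊗ₜ[ℂ] b (f p)⟫_ℂ
      = ((∑ p, ∑ q, s p * s q * ‖⟪f p, f q⟫_ℂ‖ ^ 2 : ℝ) : ℂ) := by
    simp only [sum_inner, inner_sum, inner_smul_left, inner_smul_right, TensorProduct.inner_tmul]
    push_cast
    rw [Finset.sum_comm]
    refine Finset.sum_congr rfl fun p _ => Finset.sum_congr rfl fun q _ => ?_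
    rw [hb, Complex.conj_ofReal, ← Complex.ofReal_pow, ← Complex.normSq_eq_norm_sq,
      ← Complex.mul_conj, inner_conj_symm]
    ring
  have h' := (inner_self_eq_norm_sq_to_K (𝕜 := ℂ) (E := H ⊗[ℂ] K) _).symm.trans h
  exact Complex.ofReal_injective (by simpa using h')

/-- The weighted sum is the coefficient of `doubleOp x` between the "positive" vectors `∑ s p • f p
⊗ conj (f p)` and `∑ t q • u q ⊗ conj (u q)`. -/
theorem haagerupBound_coeffForm {ι : Type*} [Fintype ι] (x : ι → H →L[ℂ] H) :
    HaagerupBound (coeffForm x) ‖doubleOp x‖ := by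
  intro α β _ _ f u s t hf hu hs ht
  let z : ∀ {γ : Type} [Fintype γ] (f : γ → H) (s : γ → ℝ), H ⊗[ℂ] ConjSpace H := fun f s =>
    ∑ p, ((s p : ℂ) • f p) ⊗ₜ[ℂ] ConjSpace.bar (f p)
  have hz : ∀ {γ : Type} [Fintype γ] (f : γ → H) (s : γ → ℝ), IsBessel f → ‖z f s‖ ≤ l2 s :=
    fun f s hf => hf.norm_sum_tmul_le (b := ConjSpace.bar) (fun _ _ => rfl) s
  have key : ⟪z f s, doubleOp x (z u t)⟫_ℂ
      = ((∑ p, ∑ q, s p * t q * ‖coeffForm x (f p) (u q)‖ ^ 2 : ℝ) : ℂ) := by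
    simp only [z, map_sum, sum_inner, inner_sum, inner_tmul_doubleOp, LinearMap.map_smulₛₗ,
      LinearMap.smul_apply, inner_smul_right]
    push_cast
    rw [Finset.sum_comm]
    refine Finset.sum_congr rfl fun p _ => Finset.sum_congr rfl fun q _ => ?_
    change _ * (_ * ⟪coeffForm x (f p) (u q), coeffForm x (f p) (u q)⟫_ℂ) = _
    rw [inner_self_eq_norm_sq_to_K, Complex.conj_ofReal]
    simp only [Complex.coe_algebraMap, id]
    ring
  have h1 := norm_inner_apply_le (doubleOp x) (z f s) (z u t)
  rw [key, Complex.norm_real] at h1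
  refine (le_abs_self _).trans (h1.trans ?_)
  gcongr
  · exact l2_nonneg s
  · exact hz f s hf
  · exact hz u t hu

/-- Writing both test tensors along orthonormal families of the second leg makes each coefficient an
instance of Haagerup's inequality with `Φ = Ψ`. -/
theorem norm_doubleOp_le {ι : Type*} [Fintype ι] {x : ι → H →L[ℂ] H} {c : ℝ} (hc : 0 ≤ c)
    (h : HaagerupBound (coeffForm x) c) : ‖doubleOp x‖ ≤ c := by
  refine opNorm_le_of_norm_inner_le _ hc fun z w => ?_
  obtain ⟨n, k, g, hk, rfl⟩ := exists_eq_sum_tmul_orthonormal z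
  obtain ⟨n', m, g', hm, rfl⟩ := exists_eq_sum_tmul_orthonormal w
  rw [norm_sum_tmul_of_orthonormal hk, norm_sum_tmul_of_orthonormal hm]
  have hon : ∀ {N : ℕ} {a : Fin N → ConjSpace H}, Orthonormal ℂ a →
      Orthonormal ℂ fun r => ConjSpace.unbar (a r) := fun ha =>
    ⟨ha.1, fun r r' hr => ha.2 hr.symm⟩
  have h1 := h.norm_sum_inner_le hc hc h (hon hk).isBessel (hon hm).isBessel g g'
  rw [Real.mul_self_sqrt hc] at h1
  rw [Finset.sum_comm] at h1
  simpa only [map_sum, sum_inner, inner_sum, inner_tmul_doubleOp] using h1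

end Coefficients

theorem OperatorSpace.minNorm_sum_bar {E : OperatorSpace.{u}} {n : ℕ} (x : Fin n → E) :
    (OperatorSpace.minNorm (∑ i, x i ⊗ₜ[ℂ] OperatorSpace.bar (x i)) : ℝ)
      = ‖doubleOp fun i => (x i : E.H →L[ℂ] E.H)‖ := by
  rw [OperatorSpace.minNorm, map_sum]
  rfl

theorem OperatorSpace.inner_matOp {H : Type*} [NormedAddCommGroup H] [InnerProductSpace ℂ H] {n : ℕ}
    (x : Matrix (Fin n) (Fin n) (H →L[ℂ] H)) (g h : PiLp 2 fun _ : Fin n => H) :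
    ⟪g, OperatorSpace.matOp x h⟫_ℂ = ∑ k, ∑ l, ⟪g k, x k l (h l)⟫_ℂ := by
  rw [PiLp.inner_apply]
  refine Finset.sum_congr rfl fun k _ => ?_
  rw [← inner_sum]
  congr 1
  simp [OperatorSpace.matOp]

theorem matNorm_operatorSpace_le_iff {E : OperatorSpace.{u}} {n : ℕ} (x : Matrix (Fin n) (Fin n) E)
    {c : ℝ} (hc : 0 ≤ c) :
    (matNorm x : ℝ) ≤ c ↔ ∀ g h : Fin n → E.H,
      ‖∑ k, ∑ l, ⟪g k, (x k l : E.H →L[ℂ] E.H) (h l)⟫_ℂ‖ ≤ c * (l2 g * l2 h) := by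
  let A := OperatorSpace.matOp (x.map fun e => (e : E.H →L[ℂ] E.H))
  have hA : ∀ g h : PiLp 2 (fun _ : Fin n => E.H),
      ⟪g, A h⟫_ℂ = ∑ k, ∑ l, ⟪g k, (x k l : E.H →L[ℂ] E.H) (h l)⟫_ℂ := by
    intro g h
    rw [OperatorSpace.inner_matOp]
    rfl
  have hn : ∀ g : PiLp 2 (fun _ : Fin n => E.H), ‖g‖ = l2 fun k => g k := fun g => by
    rw [PiLp.norm_eq_of_L2]; rfl
  change ‖A‖ ≤ c ↔ _
  constructor
  · intro h g h'
    have := norm_inner_apply_le A (WithLp.toLp 2 g) (WithLp.toLp 2 h')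
    rw [hA, hn, hn] at this
    refine this.trans ?_
    exact mul_le_mul_of_nonneg_right h (mul_nonneg (l2_nonneg _) (l2_nonneg _))
  · intro h
    refine opNorm_le_of_norm_inner_le A hc fun g h' => ?_
    rw [hA, hn, hn]
    exact h _ _

/-! ### Matrix norms of `OH(I)` as Haagerup bounds -/

/-- The sesquilinear map `(d, c) ↦ ∑ conj (d k) * c l • X k l` of a matrix of vectors. -/
def matForm {Y : Type*} [NormedAddCommGroup Y] [InnerProductSpace ℂ Y] {n : ℕ}
    (X : Matrix (Fin n) (Fin n) Y) :
    EuclideanSpace ℂ (Fin n) →ₗ⋆[ℂ] EuclideanSpace ℂ (Fin n) →ₗ[ℂ] Y :=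
  LinearMap.mk₂'ₛₗ (starRingEnd ℂ) (RingHom.id ℂ)
    (fun d c => ∑ k, ∑ l, (conj (d k) * c l) • X k l)
    (fun d d' c => by simp [add_mul, add_smul, Finset.sum_add_distrib])
    (fun a d c => by simp [Finset.smul_sum, smul_smul, mul_assoc])
    (fun d c c' => by simp [mul_add, add_smul, Finset.sum_add_distrib])
    (fun a d c => by simp [Finset.smul_sum, smul_smul, mul_left_comm])

theorem matForm_apply {Y : Type*} [NormedAddCommGroup Y] [InnerProductSpace ℂ Y] {n : ℕ}
    (X : Matrix (Fin n) (Fin n) Y) (d c : EuclideanSpace ℂ (Fin n)) :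
    matForm X d c = ∑ k, ∑ l, (conj (d k) * c l) • X k l := rfl

section Gram

variable {I : Type u} {n : ℕ}

theorem inner_toEuclideanCLM_ohGram (X : Matrix (Fin n) (Fin n) (OH I))
    (ξ η : EuclideanSpace ℂ (Fin n × Fin n)) :
    ⟪ξ, Matrix.toEuclideanCLM (n := Fin n × Fin n) (𝕜 := ℂ) (ohGram X) η⟫_ℂ =
      ∑ k', ∑ l', ∑ k, ∑ l, conj (ξ (k, k')) * η (l, l') * ⟪X k' l', X k l⟫_ℂ := by
  rw [PiLp.inner_apply]
  simp only [Matrix.ofLp_toEuclideanCLM, Matrix.mulVec, dotProduct, RCLike.inner_apply,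
    Fintype.sum_prod_type, ohGram, Matrix.of_apply, Finset.sum_mul]
  rw [Finset.sum_comm]
  refine Finset.sum_congr rfl fun k' _ => ?_
  have : ∀ k, ∑ l, ∑ l', ⟪X k' l', X k l⟫_ℂ * η (l, l') * conj (ξ (k, k'))
      = ∑ l', ∑ l, ⟪X k' l', X k l⟫_ℂ * η (l, l') * conj (ξ (k, k')) :=
    fun k => Finset.sum_comm
  simp only [this]
  rw [Finset.sum_comm]
  refine Finset.sum_congr rfl fun l' _ => Finset.sum_congr rfl fun k _ =>
    Finset.sum_congr rfl fun l _ => by ring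

theorem haagerupBound_matForm (X : Matrix (Fin n) (Fin n) (OH I)) :
    HaagerupBound (matForm X)
      ‖Matrix.toEuclideanCLM (n := Fin n × Fin n) (𝕜 := ℂ) (ohGram X)‖ := by
  intro α β _ _ d c s t hd hc hs ht
  -- The coordinates of `∑ s p • d p ⊗ conj (d p)`, the test vectors used for `doubleOp`.
  let z : ∀ {γ : Type} [Fintype γ] (d : γ → EuclideanSpace ℂ (Fin n)) (s : γ → ℝ),
      EuclideanSpace ℂ (Fin n × Fin n) := fun d s =>
    WithLp.toLp 2 fun k => ∑ p, (s p : ℂ) * (d p k.1 * conj (d p k.2))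
  have hz : ∀ {γ : Type} [Fintype γ] (d : γ → EuclideanSpace ℂ (Fin n)) (s : γ → ℝ),
      IsBessel d → ‖z d s‖ ≤ l2 s := by
    intro γ _ d s hd
    refine abs_le_of_sq_le_sq' ?_ (l2_nonneg s) |>.2
    refine le_trans (le_of_eq ?_) (hd.sum_gram_sq_le s)
    have h : ⟪z d s, z d s⟫_ℂ = ((∑ p, ∑ q, s p * s q * ‖⟪d p, d q⟫_ℂ‖ ^ 2 : ℝ) : ℂ) := by
      have h1 : ∀ p q, ((‖⟪d p, d q⟫_ℂ‖ ^ 2 : ℝ) : ℂ)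
          = ∑ k, ∑ k', (conj (d p k) * d q k) * (d p k' * conj (d q k')) := by
        intro p q
        rw [← Complex.normSq_eq_norm_sq, ← Complex.mul_conj]
        simp only [PiLp.inner_apply, RCLike.inner_apply, map_sum, map_mul, Complex.conj_conj,
          Finset.sum_mul_sum]
        refine Finset.sum_congr rfl fun k _ => Finset.sum_congr rfl fun k' _ => by ring
      rw [PiLp.inner_apply]
      push_cast
      simp only [← Complex.ofReal_pow, h1, Finset.mul_sum]
      simp only [z, RCLike.inner_apply, map_sum, map_mul, Complex.conj_conj, Complex.conj_ofReal,
        Finset.sum_mul_sum, Fintype.sum_prod_type]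
      rw [sum_comm_four, Finset.sum_comm]
      refine Finset.sum_congr rfl fun p _ => Finset.sum_congr rfl fun q _ =>
        Finset.sum_congr rfl fun k _ => Finset.sum_congr rfl fun k' _ => by ring
    rw [inner_self_eq_norm_sq_to_K] at h
    exact Complex.ofReal_injective (by simpa using h)
  have key : ⟪z d s, Matrix.toEuclideanCLM (n := Fin n × Fin n) (𝕜 := ℂ) (ohGram X) (z c t)⟫_ℂ
      = ((∑ p, ∑ q, s p * t q * ‖matForm X (d p) (c q)‖ ^ 2 : ℝ) : ℂ) := by
    have h1 : ∀ p q, ((‖matForm X (d p) (c q)‖ ^ 2 : ℝ) : ℂ) =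
        ∑ k', ∑ l', ∑ k, ∑ l, (d p k' * conj (c q l')) * (conj (d p k) * c q l) *
          ⟪X k' l', X k l⟫_ℂ := by
      intro p q
      have : ((‖matForm X (d p) (c q)‖ ^ 2 : ℝ) : ℂ)
          = ⟪matForm X (d p) (c q), matForm X (d p) (c q)⟫_ℂ := by
        rw [inner_self_eq_norm_sq_to_K]; simp
      rw [this]
      simp only [matForm_apply, sum_inner, inner_smul_left, map_mul, Complex.conj_conj]
      refine Finset.sum_congr rfl fun k' _ => Finset.sum_congr rfl fun l' _ => ?_
      simp only [inner_sum, inner_smul_right, Finset.mul_sum, mul_assoc]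
    rw [inner_toEuclideanCLM_ohGram]
    have h2 : ∀ k' l' k l, conj (z d s (k, k')) * z c t (l, l') * ⟪X k' l', X k l⟫_ℂ
        = ∑ p, ∑ q, ((s p : ℂ) * t q) *
          ((d p k' * conj (c q l')) * (conj (d p k) * c q l) * ⟪X k' l', X k l⟫_ℂ) := by
      intro k' l' k l
      simp only [z, map_sum, map_mul, Complex.conj_conj, Complex.conj_ofReal, Finset.sum_mul,
        Finset.mul_sum]
      rw [Finset.sum_comm]
      refine Finset.sum_congr rfl fun p _ => Finset.sum_congr rfl fun q _ => by ring
    simp only [h2]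
    push_cast
    simp only [← Complex.ofReal_pow, h1, Finset.mul_sum]
    have h3 : ∀ k' l', ∑ k, ∑ l, ∑ p, ∑ q, ((s p : ℂ) * t q) *
          ((d p k' * conj (c q l')) * (conj (d p k) * c q l) * ⟪X k' l', X k l⟫_ℂ) =
        ∑ p, ∑ q, ∑ k, ∑ l, ((s p : ℂ) * t q) *
          ((d p k' * conj (c q l')) * (conj (d p k) * c q l) * ⟪X k' l', X k l⟫_ℂ) :=
      fun k' l' => sum_comm_four _
    simp only [h3]
    exact sum_comm_four _
  have h1 := norm_inner_apply_le
    (Matrix.toEuclideanCLM (n := Fin n × Fin n) (𝕜 := ℂ) (ohGram X)) (z d s) (z c t)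
  rw [key, Complex.norm_real] at h1
  refine (le_abs_self _).trans (h1.trans ?_)
  gcongr
  · exact l2_nonneg s
  · exact hz d s hd
  · exact hz c t hc

/-- The norm of `ohGram X` is bounded by bounds on its coefficients. -/
theorem norm_ohGram_le_of_coeff (X : Matrix (Fin n) (Fin n) (OH I)) {c : ℝ} (hc : 0 ≤ c)
    (h : ∀ g g' : Fin n → EuclideanSpace ℂ (Fin n),
      ‖∑ k', ∑ l', ⟪X k' l', matForm X (g k') (g' l')⟫_ℂ‖ ≤ c * (l2 g * l2 g')) :
    ‖Matrix.toEuclideanCLM (n := Fin n × Fin n) (𝕜 := ℂ) (ohGram X)‖ ≤ c := by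
  refine opNorm_le_of_norm_inner_le _ hc fun ξ η => ?_
  have hl : ∀ ξ : EuclideanSpace ℂ (Fin n × Fin n),
      ‖ξ‖ = l2 fun k' => (WithLp.toLp 2 fun k => ξ (k, k') : EuclideanSpace ℂ (Fin n)) := by
    intro ξ
    rw [EuclideanSpace.norm_eq, l2, Fintype.sum_prod_type, Finset.sum_comm]
    simp [EuclideanSpace.norm_sq_eq]
  rw [inner_toEuclideanCLM_ohGram, hl ξ, hl η]
  refine le_trans (le_of_eq ?_) (h _ _)
  congr 1
  refine Finset.sum_congr rfl fun k' _ => Finset.sum_congr rfl fun l' _ => ?_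
  simp only [matForm_apply, inner_sum, inner_smul_right]

theorem matForm_basisFun (X : Matrix (Fin n) (Fin n) (OH I)) (k l : Fin n) :
    matForm X (EuclideanSpace.basisFun (Fin n) ℂ k) (EuclideanSpace.basisFun (Fin n) ℂ l)
      = X k l := by
  rw [matForm_apply, Finset.sum_eq_single k, Finset.sum_eq_single l]
  · simp
  · intro l' _ hl; simp [hl]
  · simp
  · intro k' _ hk; simp [hk]
  · simp

/-- Haagerup's inequality with `Φ = Ψ = matForm X`, the standard basis in the arguments of `Ψ`. -/
theorem norm_ohGram_le (X : Matrix (Fin n) (Fin n) (OH I)) {c : ℝ} (hc : 0 ≤ c)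
    (h : HaagerupBound (matForm X) c) :
    ‖Matrix.toEuclideanCLM (n := Fin n × Fin n) (𝕜 := ℂ) (ohGram X)‖ ≤ c := by
  refine norm_ohGram_le_of_coeff X hc fun g g' => ?_
  have hb := (EuclideanSpace.basisFun (Fin n) ℂ).orthonormal.isBessel
  have := h.norm_sum_inner_le hc hc h hb hb g g'
  rwa [Real.mul_self_sqrt hc, Finset.sum_congr rfl fun k _ => Finset.sum_congr rfl fun l _ => by
    rw [matForm_basisFun]] at this

theorem matNorm_OH_sq (X : Matrix (Fin n) (Fin n) (OH I)) :
    (matNorm X : ℝ) ^ 2 = ‖Matrix.toEuclideanCLM (n := Fin n × Fin n) (𝕜 := ℂ) (ohGram X)‖ := by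
  change ((NNReal.sqrt _ : ℝ≥0) : ℝ) ^ 2 = _
  rw [← NNReal.coe_pow, NNReal.sq_sqrt]
  rfl

end Gram

/-! ### Completely bounded norms -/

/-- Matrix norms that are homogeneous and definite. -/
class LawfulMatrixNormed (V : Type*) [AddCommGroup V] [Module ℂ V] [MatrixNormed V] : Prop where
  matNorm_smul : ∀ {n : ℕ} (c : ℂ) (x : Matrix (Fin n) (Fin n) V),
    matNorm (c • x) = ‖c‖₊ * matNorm x
  eq_zero_of_matNorm : ∀ {n : ℕ} (x : Matrix (Fin n) (Fin n) V), matNorm x = 0 → x = 0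

open LawfulMatrixNormed

instance OperatorSpace.instLawfulMatrixNormed (E : OperatorSpace.{u}) : LawfulMatrixNormed E where
  matNorm_smul {n} c x := by
    change ‖OperatorSpace.matOp (H := E.H) _‖₊ = ‖c‖₊ * ‖OperatorSpace.matOp (H := E.H) _‖₊
    rw [← nnnorm_smul]
    congr 1
    ext h k
    simp [OperatorSpace.matOp, Finset.smul_sum]
  eq_zero_of_matNorm {n} x hx := by
    classical
    have h := (matNorm_operatorSpace_le_iff x le_rfl).1 (by rw [hx]; simp)
    refine Matrix.ext fun k l => Subtype.ext ?_
    refine ContinuousLinearMap.ext fun u => ?_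
    have h1 := h (Pi.single k ((x k l : E.H →L[ℂ] E.H) u)) (Pi.single l u)
    rw [Finset.sum_eq_single k, Finset.sum_eq_single l] at h1
    · simpa using h1
    · intro l' _ hl; simp [hl]
    · simp
    · intro k' _ hk; simp [hk]
    · simp

instance OH.instLawfulMatrixNormed (I : Type u) : LawfulMatrixNormed (OH I) where
  matNorm_smul {n} c x := by
    have h : ohGram (c • x) = ((‖c‖ ^ 2 : ℝ) : ℂ) • ohGram x := by
      ext p q
      simp only [ohGram, Matrix.of_apply, Matrix.smul_apply, inner_smul_left, inner_smul_right,
        smul_eq_mul]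
      rw [← Complex.normSq_eq_norm_sq, ← Complex.mul_conj]
      ring
    rw [← NNReal.coe_inj, NNReal.coe_mul, ← sq_eq_sq₀ (by positivity) (by positivity), mul_pow,
      matNorm_OH_sq, matNorm_OH_sq, h, map_smul, norm_smul]
    simp
  eq_zero_of_matNorm {n} x hx := by
    have h := matNorm_OH_sq x
    rw [hx] at h
    have h1 : ohGram x = 0 := by
      have := norm_eq_zero.1 (h.symm.trans (by simp))
      simpa using this
    refine Matrix.ext fun k l => ?_
    have := congrFun (congrFun h1 (k, k)) (l, l)
    simpa [ohGram] using this

section CbNorm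

variable {V W X : Type*} [AddCommGroup V] [Module ℂ V] [MatrixNormed V]
    [AddCommGroup W] [Module ℂ W] [MatrixNormed W] [AddCommGroup X] [Module ℂ X] [MatrixNormed X]

theorem matNorm_zero [LawfulMatrixNormed V] {n : ℕ} :
    matNorm (0 : Matrix (Fin n) (Fin n) V) = 0 := by
  simpa using matNorm_smul (0 : ℂ) (0 : Matrix (Fin n) (Fin n) V)

theorem matNorm_map_le [LawfulMatrixNormed V] [LawfulMatrixNormed W] (T : V →ₗ[ℂ] W) {n : ℕ}
    (x : Matrix (Fin n) (Fin n) V) :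
    (matNorm (x.map T) : ℝ≥0∞) ≤ cbNorm T * (matNorm x : ℝ≥0∞) := by
  rcases eq_or_ne (matNorm x) 0 with h0 | h0
  · rw [eq_zero_of_matNorm x h0]
    have : (0 : Matrix (Fin n) (Fin n) V).map T = 0 := by ext; simp
    rw [this, matNorm_zero]
    simp
  · have hc : ‖(((matNorm x)⁻¹ : ℝ≥0) : ℂ)‖₊ = (matNorm x)⁻¹ := by
      ext; simp
    have h1 : (matNorm (((((matNorm x)⁻¹ : ℝ≥0) : ℂ) • x).map T) : ℝ≥0∞) ≤ cbNorm T := by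
      refine le_iSup₂_of_le n _ (le_iSup_of_le ?_ le_rfl)
      rw [matNorm_smul, hc, inv_mul_cancel₀ h0]
    have h2 : ((((matNorm x)⁻¹ : ℝ≥0) : ℂ) • x).map T
        = (((matNorm x)⁻¹ : ℝ≥0) : ℂ) • x.map T := by
      ext; simp
    rw [h2, matNorm_smul, hc] at h1
    calc (matNorm (x.map T) : ℝ≥0∞)
        = (((matNorm x)⁻¹ * matNorm (x.map T) : ℝ≥0) : ℝ≥0∞) * (matNorm x : ℝ≥0∞) := by
          rw [← ENNReal.coe_mul]; congr 1; field_simp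
      _ ≤ _ := by gcongr

theorem cbNorm_le {T : V →ₗ[ℂ] W} {C : ℝ≥0∞}
    (h : ∀ (n : ℕ) (x : Matrix (Fin n) (Fin n) V), (matNorm (x.map T) : ℝ≥0∞) ≤ C * matNorm x) :
    cbNorm T ≤ C := by
  refine iSup₂_le fun n x => iSup_le fun hx => (h n x).trans ?_
  calc C * (matNorm x : ℝ≥0∞) ≤ C * 1 := by gcongr; exact_mod_cast hx
    _ = C := mul_one C

theorem cbNorm_comp_le [LawfulMatrixNormed V] [LawfulMatrixNormed W] [LawfulMatrixNormed X]
    (S : W →ₗ[ℂ] X) (T : V →ₗ[ℂ] W) : cbNorm (S ∘ₗ T) ≤ cbNorm S * cbNorm T := by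
  refine cbNorm_le fun n x => ?_
  have h : x.map (S ∘ₗ T) = (x.map T).map S := by ext; simp
  rw [h]
  refine (matNorm_map_le S _).trans ?_
  rw [mul_assoc]
  gcongr
  exact matNorm_map_le T x

theorem eq_zero_of_cbNorm [LawfulMatrixNormed V] [LawfulMatrixNormed W] {T : V →ₗ[ℂ] W}
    (h : cbNorm T = 0) : T = 0 := by
  ext v
  have h1 := matNorm_map_le T (Matrix.of fun _ _ : Fin 1 => v)
  rw [h, zero_mul, nonpos_iff_eq_zero, ENNReal.coe_eq_zero] at h1
  exact congrFun (congrFun (eq_zero_of_matNorm _ h1) 0) 0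

theorem cbNorm_zero [LawfulMatrixNormed W] : cbNorm (0 : V →ₗ[ℂ] W) = 0 := by
  refine nonpos_iff_eq_zero.1 (cbNorm_le fun n x => ?_)
  have : x.map (0 : V →ₗ[ℂ] W) = 0 := by ext; simp
  rw [this, matNorm_zero]
  simp

theorem cbNorm_smul_le [LawfulMatrixNormed V] [LawfulMatrixNormed W] (c : ℂ) (T : V →ₗ[ℂ] W) :
    cbNorm (c • T) ≤ ‖c‖ₑ * cbNorm T := by
  refine cbNorm_le fun n x => ?_
  have : x.map (c • T) = c • x.map T := by ext; simp
  rw [this, matNorm_smul, ENNReal.coe_mul, mul_assoc]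
  gcongr
  · exact le_rfl
  · exact matNorm_map_le T x

theorem IsCompleteIsometry.cbNorm_le_one {T : V →ₗ[ℂ] W} (h : IsCompleteIsometry T) :
    cbNorm T ≤ 1 :=
  cbNorm_le fun n x => by rw [h n x, one_mul]

theorem matNorm_map_le_of_cbNorm_le [LawfulMatrixNormed V] [LawfulMatrixNormed W]
    {T : V →ₗ[ℂ] W} {C : ℝ≥0} (h : cbNorm T ≤ C) {n : ℕ} (x : Matrix (Fin n) (Fin n) V) :
    (matNorm (x.map T) : ℝ) ≤ C * matNorm x := by
  have := (matNorm_map_le T x).trans (mul_le_mul_left h _)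
  exact_mod_cast this

end CbNorm

/-! ### The `(2, oh)`-summing norm -/

section Summing

theorem doubleOp_comp_equiv {H ι κ : Type*} [NormedAddCommGroup H] [InnerProductSpace ℂ H]
    [Fintype ι] [Fintype κ] (e : κ ≃ ι) (x : ι → H →L[ℂ] H) : doubleOp (x ∘ e) = doubleOp x :=
  Equiv.sum_comp e fun i => TensorProduct.mapL (x i) (ConjSpace.barOp (x i))

variable {E : OperatorSpace.{u}} {Y : Type*} [NormedAddCommGroup Y] [NormedSpace ℂ Y]

/-- The defining inequality of the `(2, oh)`-summing norm, with constant `C`. -/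
def IsSummingBound (w : E →ₗ[ℂ] Y) (C : ℝ) : Prop :=
  ∀ ⦃ι : Type⦄ [Fintype ι] (x : ι → E),
    ∑ i, ‖w (x i)‖ ^ 2 ≤ C ^ 2 * ‖doubleOp fun i => (x i : E.H →L[ℂ] E.H)‖

theorem isSummingBound_iff {w : E →ₗ[ℂ] Y} {C : ℝ≥0} :
    IsSummingBound w C ↔ ∀ (n : ℕ) (x : Fin n → E), ∑ i, ‖w (x i)‖₊ ^ 2 ≤
      C ^ 2 * OperatorSpace.minNorm (∑ i, x i ⊗ₜ[ℂ] OperatorSpace.bar (x i)) := by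
  simp only [← NNReal.coe_le_coe, NNReal.coe_mul, OperatorSpace.minNorm_sum_bar]
  push_cast
  refine ⟨fun h n x => h x, fun h ι _ x => ?_⟩
  let e := (Fintype.equivFin ι).symm
  have := h _ (x ∘ e)
  rw [← doubleOp_comp_equiv e, ← Equiv.sum_comp e]
  exact this

theorem pi2oh_le {w : E →ₗ[ℂ] Y} {C : ℝ≥0} (h : IsSummingBound w C) : pi2oh w ≤ C :=
  iInf₂_le C (isSummingBound_iff.1 h)

theorem le_pi2oh {w : E →ₗ[ℂ] Y} {c : ℝ≥0∞} (h : ∀ C : ℝ≥0, IsSummingBound w C → c ≤ C) :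
    c ≤ pi2oh w :=
  le_iInf₂ fun C hC => h C (isSummingBound_iff.2 hC)

/-- The infimum is attained: each single inequality is closed in the constant, so one may let it
decrease to `pi2oh w`. -/
theorem isSummingBound_pi2oh {w : E →ₗ[ℂ] Y} (hw : pi2oh w ≠ ∞) :
    IsSummingBound w (pi2oh w).toReal := by
  intro ι _ x
  have hc : Filter.Tendsto (fun C : ℝ => C ^ 2 * ‖doubleOp fun i => (x i : E.H →L[ℂ] E.H)‖)
      (nhdsWithin (pi2oh w).toReal (Set.Ioi (pi2oh w).toReal))
      (nhds ((pi2oh w).toReal ^ 2 * ‖doubleOp fun i => (x i : E.H →L[ℂ] E.H)‖)) :=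
    (Continuous.tendsto (by fun_prop) _).mono_left nhdsWithin_le_nhds
  refine ge_of_tendsto hc (Filter.eventually_of_mem self_mem_nhdsWithin fun C hC => ?_)
  have hC0 : 0 ≤ C := ENNReal.toReal_nonneg.trans (le_of_lt hC)
  lift C to ℝ≥0 using hC0
  have h1 : pi2oh w < C := by
    rw [← ENNReal.ofReal_toReal hw, ← ENNReal.ofReal_coe_nnreal]
    exact (ENNReal.ofReal_lt_ofReal_iff_of_nonneg ENNReal.toReal_nonneg).2 hC
  obtain ⟨C', hC'⟩ := iInf_lt_iff.1 h1
  obtain ⟨h2, h3⟩ := iInf_lt_iff.1 hC'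
  refine (isSummingBound_iff.2 h2 x).trans ?_
  have h4 : C' ≤ C := by exact_mod_cast h3.le
  gcongr

theorem eq_zero_of_pi2oh {w : E →ₗ[ℂ] Y} (h : pi2oh w = 0) : w = 0 := by
  ext x
  have := isSummingBound_pi2oh (w := w) (by simp [h]) (fun _ : Fin 1 => x)
  simpa [h] using this

theorem pi2oh_zero : pi2oh (0 : E →ₗ[ℂ] Y) = 0 :=
  nonpos_iff_eq_zero.1 (pi2oh_le (C := 0) fun ι _ x => by simp)

theorem IsBessel.tmul {ι κ H : Type*} [Fintype ι] [Fintype κ] [NormedAddCommGroup H]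
    [InnerProductSpace ℂ H] {n : ℕ} {d : ι → EuclideanSpace ℂ (Fin n)} {f : κ → H}
    (hd : IsBessel d) (hf : IsBessel f) :
    IsBessel fun i : ι × κ =>
      (WithLp.toLp 2 fun k => d i.1 k • f i.2 : PiLp 2 fun _ : Fin n => H) := by
  intro h
  rw [Fintype.sum_prod_type, Finset.sum_comm]
  have h1 : ∀ a, ∑ p, ‖⟪(WithLp.toLp 2 fun k => d p k • f a : PiLp 2 fun _ : Fin n => H), h⟫_ℂ‖ ^ 2
      ≤ ∑ k, ‖⟪f a, h k⟫_ℂ‖ ^ 2 := by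
    intro a
    have := hd (WithLp.toLp 2 fun k => ⟪f a, h k⟫_ℂ)
    rw [EuclideanSpace.norm_sq_eq] at this
    refine le_trans (le_of_eq ?_) this
    refine Finset.sum_congr rfl fun p _ => ?_
    simp only [PiLp.inner_apply, inner_smul_left, RCLike.inner_apply, mul_comm]
  refine (Finset.sum_le_sum fun a _ => h1 a).trans ?_
  rw [Finset.sum_comm, PiLp.norm_sq_eq_of_L2]
  exact Finset.sum_le_sum fun k _ => hf (h k)

theorem l2_mul {ι κ : Type*} [Fintype ι] [Fintype κ] (s : ι → ℝ) (t : κ → ℝ) :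
    l2 (fun i : ι × κ => s i.1 * t i.2) = l2 s * l2 t := by
  rw [l2, l2, l2, ← Real.sqrt_mul (by positivity), Finset.sum_mul_sum, Fintype.sum_prod_type]
  simp [mul_pow]

/-- Schur test: by Bessel's inequality the rows and columns of `‖⟪f i, A (u j)⟫‖²` sum to at most
`‖A‖²`. -/
theorem IsBessel.sum_coeff_le {ι κ H : Type*} [Fintype ι] [Fintype κ] [NormedAddCommGroup H]
    [InnerProductSpace ℂ H] [CompleteSpace H] {f : ι → H} {u : κ → H} (hf : IsBessel f)
    (hu : IsBessel u) (A : H →L[ℂ] H) (s : ι → ℝ) (t : κ → ℝ) :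
    ∑ i, ∑ j, s i * t j * ‖⟪f i, A (u j)⟫_ℂ‖ ^ 2 ≤ ‖A‖ ^ 2 * (l2 s * l2 t) := by
  have h := schur_test s t (m := fun i j => ‖⟪f i, A (u j)⟫_ℂ‖ ^ 2) (fun _ _ => sq_nonneg _)
    (c := ‖A‖ ^ 2) (fun i => ?_) (fun j => ?_)
  · rwa [abs_of_nonneg (sq_nonneg _)] at h
  · simp only [← ContinuousLinearMap.adjoint_inner_left]
    refine (hu.sum_inner_sq_le _).trans ?_
    refine pow_le_pow_left₀ (norm_nonneg _) ((ContinuousLinearMap.le_opNorm _ _).trans ?_) 2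
    rw [LinearIsometryEquiv.norm_map]
    exact mul_le_of_le_one_right (norm_nonneg _) (hf.norm_le_one i)
  · refine (hf _).trans ?_
    refine pow_le_pow_left₀ (norm_nonneg _) ((ContinuousLinearMap.le_opNorm _ _).trans ?_) 2
    exact mul_le_of_le_one_right (norm_nonneg _) (hu.norm_le_one j)

/-- Testing the norm of `w(x)` in `M_n(OH(I))` on weighted Bessel families gives a sum `∑ ‖w y‖²`
over a finite family `y` in `E`. The summing inequality then leaves only `‖∑ y ⊗ ȳ‖ ≤ ‖x‖² * ‖s‖₂ *
‖t‖₂` to be shown. -/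
theorem cbNorm_le_pi2oh {I : Type u} (w : E →ₗ[ℂ] OH I) : cbNorm w ≤ pi2oh w := by
  refine le_pi2oh fun C hC => cbNorm_le fun n x => ?_
  rw [← ENNReal.coe_mul, ENNReal.coe_le_coe, ← NNReal.coe_le_coe,
    ← sq_le_sq₀ (NNReal.coe_nonneg _) (NNReal.coe_nonneg _), matNorm_OH_sq, NNReal.coe_mul, mul_pow]
  refine norm_ohGram_le _ (by positivity) ?_
  intro ι κ _ _ d c s t hd hc hs ht
  let z : ι → κ → E := fun p q => ∑ k, ∑ l, (conj (d p k) * c q l) • x k l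
  -- The square root absorbs the weight `s p * t q` into the vector.
  let y : ι × κ → E := fun i => ((√(s i.1 * t i.2) : ℝ) : ℂ) • z i.1 i.2
  have hy : ∀ p q, s p * t q * ‖matForm (x.map w) (d p) (c q)‖ ^ 2 = ‖w (y (p, q))‖ ^ 2 := by
    intro p q
    have : matForm (x.map w) (d p) (c q) = w (z p q) := by
      simp [matForm_apply, z]
    rw [this, map_smul, norm_smul, mul_pow, Complex.norm_real, Real.norm_eq_abs, sq_abs,
      Real.sq_sqrt (mul_nonneg (hs p) (ht q))]
  simp only [hy]
  rw [← Fintype.sum_prod_type']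
  refine (hC y).trans ?_
  rw [mul_assoc]
  refine mul_le_mul_of_nonneg_left (norm_doubleOp_le ?_ ?_) (sq_nonneg _)
  · exact mul_nonneg (sq_nonneg _) (mul_nonneg (l2_nonneg _) (l2_nonneg _))
  intro α β _ _ f u σ τ hf hu hσ hτ
  -- The coefficients of `z p q` are those of the single operator `matOp x` on the Bessel families
  -- `d ⊗ f` and `c ⊗ u`.
  have h := (hd.tmul hf).sum_coeff_le (hc.tmul hu)
    (OperatorSpace.matOp (x.map fun e => (e : E.H →L[ℂ] E.H)))
    (fun i => s i.1 * σ i.2) (fun j => t j.1 * τ j.2)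
  have hz : ∀ p a q b, ⟪(WithLp.toLp 2 fun k => d p k • f a : PiLp 2 fun _ : Fin n => E.H),
      OperatorSpace.matOp (x.map fun e => (e : E.H →L[ℂ] E.H))
        (WithLp.toLp 2 fun k => c q k • u b : PiLp 2 fun _ : Fin n => E.H)⟫_ℂ
      = ⟪f a, (z p q : E.H →L[ℂ] E.H) (u b)⟫_ℂ := by
    intro p a q b
    rw [OperatorSpace.inner_matOp]
    simp only [z, inner_smul_left, inner_smul_right, inner_sum, Submodule.coe_sum,
      Submodule.coe_smul, _root_.sum_apply, _root_.smul_apply, map_smul, Matrix.map_apply]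
    refine Finset.sum_congr rfl fun k _ => Finset.sum_congr rfl fun l _ => ?_
    ring
  rw [l2_mul, l2_mul] at h
  simp only [hz, Fintype.sum_prod_type] at h
  change _ ≤ ‖OperatorSpace.matOp (x.map fun e => (e : E.H →L[ℂ] E.H))‖ ^ 2 * _ * _
  refine le_trans (le_of_eq ?_) (h.trans (le_of_eq (by ring)))
  have hyz : ∀ a b, σ a * τ b * ‖coeffForm (fun i => (y i : E.H →L[ℂ] E.H)) (f a) (u b)‖ ^ 2 =
      ∑ p, ∑ q, s p * σ a * (t q * τ b) * ‖⟪f a, (z p q : E.H →L[ℂ] E.H) (u b)⟫_ℂ‖ ^ 2 := by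
    intro a b
    rw [EuclideanSpace.norm_sq_eq, Fintype.sum_prod_type, Finset.mul_sum]
    refine Finset.sum_congr rfl fun p _ => ?_
    rw [Finset.mul_sum]
    refine Finset.sum_congr rfl fun q _ => ?_
    simp only [coeffForm_apply, y, Submodule.coe_smul, _root_.smul_apply, inner_smul_right,
      norm_mul, mul_pow, Complex.norm_real, Real.norm_eq_abs, sq_abs]
    rw [Real.sq_sqrt (mul_nonneg (hs p) (ht q))]
    ring
  simp only [hyz]
  rw [sum_comm_four]
  exact Finset.sum_congr rfl fun p _ => Finset.sum_comm

end Summing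

/-! ### Completely bounded maps and Haagerup bounds -/

/-- Used for self-improvement: duality arguments bound a norm by a constant times its own square
root. -/
theorem le_sq_of_le_mul_sqrt {x c : ℝ} (hx : 0 ≤ x) (h : x ≤ c * √x) : x ≤ c ^ 2 := by
  rcases eq_or_lt_of_le hx with h0 | h0
  · rw [← h0]; positivity
  · have h1 : 0 < √x := Real.sqrt_pos.2 h0
    have h2 : √x ≤ c := by
      by_contra! h3
      nlinarith [Real.mul_self_sqrt hx]
    calc x = √x ^ 2 := (Real.sq_sqrt hx).symm
      _ ≤ c ^ 2 := by gcongr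

theorem l2_smul_le_of_isBessel {ι H : Type*} [Fintype ι] [NormedAddCommGroup H]
    [InnerProductSpace ℂ H] {f : ι → H} (hf : IsBessel f) (s : ι → ℝ) :
    l2 (fun p => (s p : ℂ) • f p) ≤ l2 s := by
  refine Real.sqrt_le_sqrt (Finset.sum_le_sum fun p _ => ?_)
  rw [norm_smul, Complex.norm_real]
  exact pow_le_pow_left₀ (by positivity)
    (mul_le_of_le_one_right (norm_nonneg _) (hf.norm_le_one p)) 2

section Square

variable {H K Y : Type*} [NormedAddCommGroup H] [InnerProductSpace ℂ H]
  [NormedAddCommGroup K] [InnerProductSpace ℂ K] [NormedAddCommGroup Y] [InnerProductSpace ℂ Y]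

/-- A Haagerup bound need only be checked on families indexed by the same `Fin n`. -/
theorem HaagerupBound.of_square {Φ : H →ₗ⋆[ℂ] K →ₗ[ℂ] Y} {c : ℝ}
    (h : ∀ (n : ℕ) (f : Fin n → H) (u : Fin n → K) (s t : Fin n → ℝ), IsBessel f → IsBessel u →
      (∀ p, 0 ≤ s p) → (∀ q, 0 ≤ t q) →
      ∑ p, ∑ q, s p * t q * ‖Φ (f p) (u q)‖ ^ 2 ≤ c * (l2 s * l2 t)) :
    HaagerupBound Φ c := by
  intro ι κ _ _ f u s t hf hu hs ht
  -- Both families are padded by zeros to the common index type `ι ⊕ κ`, since matrix norms are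
  -- available for square matrices only.
  let e := (Fintype.equivFin (ι ⊕ κ)).symm
  have h1 := h _ (Sum.elim f (fun _ => 0) ∘ e) (Sum.elim (fun _ => 0) u ∘ e)
    (Sum.elim s (fun _ => 0) ∘ e) (Sum.elim (fun _ => 0) t ∘ e)
    (fun y => by
      have := Equiv.sum_comp e fun i => ‖⟪Sum.elim f (fun _ => 0) i, y⟫_ℂ‖ ^ 2
      refine (le_of_eq this).trans ?_
      simpa using hf y)
    (fun y => by
      have := Equiv.sum_comp e fun i => ‖⟪Sum.elim (fun _ => 0) u i, y⟫_ℂ‖ ^ 2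
      refine (le_of_eq this).trans ?_
      simpa using hu y)
    (fun p => by
      change 0 ≤ Sum.elim s (fun _ => 0) (e p)
      rcases e p with i | j
      · exact hs i
      · exact le_rfl)
    (fun q => by
      change 0 ≤ Sum.elim (fun _ => 0) t (e q)
      rcases e q with i | j
      · exact le_rfl
      · exact ht j)
  have h2 : l2 (Sum.elim s (fun _ : κ => 0) ∘ e) = l2 s := by
    have := Equiv.sum_comp e fun i => ‖Sum.elim s (fun _ => 0) i‖ ^ 2
    unfold l2
    refine (congrArg Real.sqrt this).trans ?_
    simp
  have h3 : l2 (Sum.elim (fun _ : ι => 0) t ∘ e) = l2 t := by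
    have := Equiv.sum_comp e fun i => ‖Sum.elim (fun _ => 0) t i‖ ^ 2
    unfold l2
    refine (congrArg Real.sqrt this).trans ?_
    simp
  rw [h2, h3] at h1
  refine le_trans (le_of_eq ?_) h1
  let m : ι ⊕ κ → ι ⊕ κ → ℝ := fun i j => Sum.elim s (fun _ => 0) i * Sum.elim (fun _ => 0) t j *
    ‖Φ (Sum.elim f (fun _ => 0) i) (Sum.elim (fun _ => 0) u j)‖ ^ 2
  change _ = ∑ p, ∑ q, m (e p) (e q)
  rw [Equiv.sum_comp e fun i => ∑ q, m i (e q)]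
  have h4 : ∀ i, ∑ q, m i (e q) = ∑ j, m i j := fun i => Equiv.sum_comp e (m i)
  simp [h4, m]

end Square

/-- `a ⊗ ā` increases minimal norms of the tensors `∑ xᵢ ⊗ x̄ᵢ` at most by `‖a‖_cb ^ 2`. -/
theorem norm_doubleOp_map_le {D E : OperatorSpace.{u}} {a : D →ₗ[ℂ] E} {C : ℝ≥0}
    (ha : cbNorm a ≤ C) {ι : Type} [Fintype ι] (x : ι → D) :
    ‖doubleOp fun i => (a (x i) : E.H →L[ℂ] E.H)‖ ≤
      C ^ 2 * ‖doubleOp fun i => (x i : D.H →L[ℂ] D.H)‖ := by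
  set Ψ := coeffForm fun i => (a (x i) : E.H →L[ℂ] E.H)
  set N := ‖doubleOp fun i => (x i : D.H →L[ℂ] D.H)‖
  set N' := ‖doubleOp fun i => (a (x i) : E.H →L[ℂ] E.H)‖
  have hN : 0 ≤ N := norm_nonneg (doubleOp fun i => (x i : D.H →L[ℂ] D.H))
  have hN' : 0 ≤ N' := norm_nonneg (doubleOp fun i => (a (x i) : E.H →L[ℂ] E.H))
  have key : N' ≤ C * √N * √N' := by
    refine norm_doubleOp_le (by positivity) (HaagerupBound.of_square fun n f u s t hf hu hs ht => ?_)
    -- A dual test matrix: its coefficients pair the forms of `x` and of `a(x)`, so Haagerup's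
    -- inequality gives `‖X‖ ≤ √N * √N'`. Applying `a` and evaluating on `s p • f p`, `t q • u q`
    -- recovers the weighted sum of `‖Ψ‖²`.
    let X : Matrix (Fin n) (Fin n) D := Matrix.of fun p q => ∑ i, conj (Ψ (f p) (u q) i) • x i
    have hX : (matNorm X : ℝ) ≤ √N * √N' := by
      refine (matNorm_operatorSpace_le_iff X (by positivity)).2 fun g h => ?_
      have h1 := (haagerupBound_coeffForm fun i => (x i : D.H →L[ℂ] D.H)).norm_sum_inner_le
        hN hN' (haagerupBound_coeffForm fun i => (a (x i) : E.H →L[ℂ] E.H)) hf hu g h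
      rw [mul_comm √N' √N] at h1
      refine le_trans (le_of_eq ?_) h1
      congr 1
      refine Finset.sum_congr rfl fun k _ => Finset.sum_congr rfl fun l _ => ?_
      simp only [X, Matrix.of_apply, Submodule.coe_sum, Submodule.coe_smul, _root_.sum_apply,
        _root_.smul_apply, inner_sum, inner_smul_right, PiLp.inner_apply, RCLike.inner_apply,
        coeffForm_apply]
      exact Finset.sum_congr rfl fun i _ => mul_comm _ _
    have h2 := (matNorm_operatorSpace_le_iff (X.map a) (by positivity)).1
      (matNorm_map_le_of_cbNorm_le ha X) (fun p => (s p : ℂ) • f p) (fun q => (t q : ℂ) • u q)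
    have h3 : ∑ k, ∑ l, ⟪(s k : ℂ) • f k, ((X.map a) k l : E.H →L[ℂ] E.H) ((t l : ℂ) • u l)⟫_ℂ
        = ((∑ p, ∑ q, s p * t q * ‖Ψ (f p) (u q)‖ ^ 2 : ℝ) : ℂ) := by
      push_cast
      refine Finset.sum_congr rfl fun p _ => Finset.sum_congr rfl fun q _ => ?_
      rw [← Complex.ofReal_pow, EuclideanSpace.norm_sq_eq]
      simp only [X, Matrix.map_apply, Matrix.of_apply, map_sum, map_smul, Submodule.coe_sum,
        Submodule.coe_smul, _root_.sum_apply, _root_.smul_apply, inner_sum, inner_smul_right,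
        inner_smul_left, Complex.conj_ofReal, Complex.ofReal_sum, Finset.mul_sum]
      refine Finset.sum_congr rfl fun i _ => ?_
      rw [← Complex.normSq_eq_norm_sq, ← Complex.mul_conj]
      change _ * (_ * (_ * Ψ (f p) (u q) i)) = _
      ring
    rw [h3, Complex.norm_real] at h2
    refine (le_abs_self _).trans (h2.trans ?_)
    refine mul_le_mul ?_ (mul_le_mul (l2_smul_le_of_isBessel hf s) (l2_smul_le_of_isBessel hu t)
      (l2_nonneg _) (l2_nonneg _)) (mul_nonneg (l2_nonneg _) (l2_nonneg _)) (by positivity)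
    rw [mul_assoc]
    exact mul_le_mul_of_nonneg_left hX C.coe_nonneg
  have := le_sq_of_le_mul_sqrt hN' key
  rwa [mul_pow, Real.sq_sqrt hN] at this

theorem IsSummingBound.comp {D E : OperatorSpace.{u}} {Y : Type*} [NormedAddCommGroup Y]
    [NormedSpace ℂ Y] {w : E →ₗ[ℂ] Y} {B : ℝ} (hw : IsSummingBound w B) {a : D →ₗ[ℂ] E} {C : ℝ≥0}
    (ha : cbNorm a ≤ C) : IsSummingBound (w ∘ₗ a) (C * B) := fun ι _ x =>
  (hw fun i => a (x i)).trans <| by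
    rw [mul_pow, mul_comm ((C : ℝ) ^ 2), mul_assoc]
    gcongr
    exact norm_doubleOp_map_le ha x

/-! ### Maps out of `OH(I)` -/

section OHMaps

variable {I J : Type u} {F : OperatorSpace.{u}} {H : Type*} [NormedAddCommGroup H]
  [InnerProductSpace ℂ H] [CompleteSpace H]

/-- The sesquilinear map sending `(f, u)` to the (conjugate of the) Riesz vector of the functional
`h ↦ ⟪f, v h u⟫`. -/
def dualForm (v : OH I →L[ℂ] H →L[ℂ] H) : H →ₗ⋆[ℂ] H →ₗ[ℂ] ConjSpace (OH I) :=
  LinearMap.mk₂'ₛₗ (starRingEnd ℂ) (RingHom.id ℂ)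
    (fun f u => ConjSpace.bar (ContinuousLinearMap.adjoint (v.flip u) f))
    (fun f f' u => by rw [map_add]; rfl)
    (fun c f u => by
      rw [map_smul]
      change _ = ConjSpace.bar ((starRingEnd ℂ ((starRingEnd ℂ) c)) • _)
      rw [Complex.conj_conj]
      rfl)
    (fun f u u' => by rw [map_add, map_add]; rfl)
    (fun c f u => by rw [map_smul, map_smulₛₗ]; rfl)

theorem inner_bar_dualForm (v : OH I →L[ℂ] H →L[ℂ] H) (f u : H) (x : OH I) :
    ⟪ConjSpace.bar x, dualForm v f u⟫_ℂ = ⟪f, v x u⟫_ℂ :=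
  ContinuousLinearMap.adjoint_inner_left (v.flip u) x f

/-- The conjugate of `matForm X`. -/
def conjMatForm {n : ℕ} (X : Matrix (Fin n) (Fin n) (OH I)) :
    EuclideanSpace ℂ (Fin n) →ₗ⋆[ℂ] EuclideanSpace ℂ (Fin n) →ₗ[ℂ] ConjSpace (OH I) :=
  LinearMap.mk₂'ₛₗ (starRingEnd ℂ) (RingHom.id ℂ)
    (fun d c => ConjSpace.bar (matForm X (WithLp.toLp 2 fun k => conj (d k))
      (WithLp.toLp 2 fun k => conj (c k))))
    (fun d d' c => by
      simp only [matForm_apply, PiLp.add_apply, map_add, add_mul, add_smul, Finset.sum_add_distrib]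
      rfl)
    (fun a d c => by
      change _ = ConjSpace.bar ((starRingEnd ℂ ((starRingEnd ℂ) a)) •
        matForm X (WithLp.toLp 2 fun k => conj (d k)) (WithLp.toLp 2 fun k => conj (c k)))
      simp only [matForm_apply, PiLp.smul_apply, smul_eq_mul, map_mul, Complex.conj_conj,
        Finset.smul_sum, smul_smul, mul_assoc])
    (fun d c c' => by
      simp only [matForm_apply, PiLp.add_apply, map_add, mul_add, add_smul, Finset.sum_add_distrib]
      rfl)
    (fun a d c => by
      change _ = ConjSpace.bar ((starRingEnd ℂ) a •
        matForm X (WithLp.toLp 2 fun k => conj (d k)) (WithLp.toLp 2 fun k => conj (c k)))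
      simp only [matForm_apply, PiLp.smul_apply, smul_eq_mul, map_mul, Complex.conj_conj,
        Finset.smul_sum, smul_smul, mul_left_comm])

theorem conjMatForm_apply {n : ℕ} (X : Matrix (Fin n) (Fin n) (OH I))
    (d c : EuclideanSpace ℂ (Fin n)) :
    conjMatForm X d c = ConjSpace.bar (matForm X (WithLp.toLp 2 fun k => conj (d k))
      (WithLp.toLp 2 fun k => conj (c k))) := rfl

theorem haagerupBound_conjMatForm {n : ℕ} (X : Matrix (Fin n) (Fin n) (OH I)) :
    HaagerupBound (conjMatForm X)
      ‖Matrix.toEuclideanCLM (n := Fin n × Fin n) (𝕜 := ℂ) (ohGram X)‖ :=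
  fun _ _ _ _ d c s t hd hc hs ht =>
    haagerupBound_matForm X (fun p => WithLp.toLp 2 fun k => conj (d p k))
      (fun q => WithLp.toLp 2 fun k => conj (c q k)) s t hd.conj hc.conj hs ht

theorem conjMatForm_basisFun {n : ℕ} (X : Matrix (Fin n) (Fin n) (OH I)) (k l : Fin n) :
    conjMatForm X (EuclideanSpace.basisFun (Fin n) ℂ k) (EuclideanSpace.basisFun (Fin n) ℂ l)
      = ConjSpace.bar (X k l) := by
  have : ∀ k, (WithLp.toLp 2 fun j => conj (EuclideanSpace.basisFun (Fin n) ℂ k j)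
      : EuclideanSpace ℂ (Fin n)) = EuclideanSpace.basisFun (Fin n) ℂ k := by
    intro k
    ext j
    simp [apply_ite]
  rw [conjMatForm_apply, this, this, matForm_basisFun]

/-- A coefficient of `V(X)` is the pairing of `conjMatForm X`, bounded by `‖X‖²`, with `dualForm v`;
Haagerup's inequality bounds it by `M * ‖X‖`. -/
theorem cbNorm_le_of_haagerupBound {V : OH I →ₗ[ℂ] F} {v : OH I →L[ℂ] F.H →L[ℂ] F.H}
    (hv : ∀ h, (V h : F.H →L[ℂ] F.H) = v h) {M : ℝ≥0} (h : HaagerupBound (dualForm v) (M ^ 2)) :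
    cbNorm V ≤ M := by
  refine cbNorm_le fun n X => ?_
  rw [← ENNReal.coe_mul, ENNReal.coe_le_coe, ← NNReal.coe_le_coe, NNReal.coe_mul]
  refine (matNorm_operatorSpace_le_iff _ (by positivity)).2 fun g g' => ?_
  have hb := (EuclideanSpace.basisFun (Fin n) ℂ).orthonormal.isBessel
  have h1 := h.norm_sum_inner_le (sq_nonneg _) (norm_nonneg _) (haagerupBound_conjMatForm X)
    hb hb g g'
  rw [← matNorm_OH_sq, Real.sqrt_sq (NNReal.coe_nonneg _), Real.sqrt_sq (NNReal.coe_nonneg _),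
    mul_comm (matNorm X : ℝ)] at h1
  refine le_trans (le_of_eq ?_) h1
  congr 1
  refine Finset.sum_congr rfl fun k _ => Finset.sum_congr rfl fun l _ => ?_
  rw [conjMatForm_basisFun, inner_bar_dualForm, ← hv]
  rfl

/-- Converse by duality: `V` is applied to the matrix `X` of Riesz vectors of its own coefficients.
If `G = ‖X‖²`, this gives `G ≤ M * √G`, hence `G ≤ M²`. -/
theorem haagerupBound_of_cbNorm_le {V : OH I →ₗ[ℂ] F} {v : OH I →L[ℂ] F.H →L[ℂ] F.H}
    (hv : ∀ h, (V h : F.H →L[ℂ] F.H) = v h) {M : ℝ≥0} (h : cbNorm V ≤ M) :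
    HaagerupBound (dualForm v) (M ^ 2) := by
  refine HaagerupBound.of_square fun n f u s t hf hu hs ht => ?_
  let X : Matrix (Fin n) (Fin n) (OH I) :=
    Matrix.of fun k l => ConjSpace.unbar (dualForm v (f k) (u l))
  have hX : ∀ k l x, ⟪X k l, x⟫_ℂ = ⟪f k, v x (u l)⟫_ℂ := fun k l x =>
    inner_bar_dualForm v (f k) (u l) x
  set G := ‖Matrix.toEuclideanCLM (n := Fin n × Fin n) (𝕜 := ℂ) (ohGram X)‖ with hG
  have hcomb : ∀ {f : Fin n → F.H} (_ : IsBessel f) (g : Fin n → EuclideanSpace ℂ (Fin n)),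
      l2 (fun k => ∑ k', g k' k • f k') ≤ l2 g := by
    intro f hf g
    refine Real.sqrt_le_sqrt ?_
    simp only [EuclideanSpace.norm_sq_eq]
    rw [Finset.sum_comm]
    refine Finset.sum_le_sum fun k _ => ?_
    rw [← l2_sq]
    exact pow_le_pow_left₀ (norm_nonneg _) (hf.norm_sum_le fun k' => g k' k) 2
  have hGM : G ≤ (M : ℝ) ^ 2 := by
    refine le_sq_of_le_mul_sqrt (norm_nonneg _) ?_
    have hXG : (matNorm X : ℝ) = √G := by
      rw [hG, ← matNorm_OH_sq, Real.sqrt_sq (NNReal.coe_nonneg _)]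
    refine norm_ohGram_le_of_coeff X (by positivity) fun g g' => ?_
    have h1 := (matNorm_operatorSpace_le_iff (X.map V) (by positivity)).1
      (matNorm_map_le_of_cbNorm_le h X) (fun k => ∑ k', g k' k • f k')
      (fun l => ∑ l', g' l' l • u l')
    rw [hXG] at h1
    refine le_trans (le_of_eq ?_) (h1.trans ?_)
    · have e1 : ∀ k' l', ⟪X k' l', matForm X (g k') (g' l')⟫_ℂ = ∑ k, ∑ l,
          conj (g k' k) * g' l' l * ⟪f k', v (X k l) (u l')⟫_ℂ := fun k' l' => by
        simp only [matForm_apply, inner_sum, inner_smul_right]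
        simp only [hX]
      have e2 : ∀ k l, ⟪∑ k', g k' k • f k', (V (X k l) : F.H →L[ℂ] F.H) (∑ l', g' l' l • u l')⟫_ℂ
          = ∑ k', ∑ l', conj (g k' k) * g' l' l * ⟪f k', v (X k l) (u l')⟫_ℂ := fun k l => by
        simp only [hv, map_sum, map_smul, sum_inner, inner_sum, inner_smul_left,
          inner_smul_right, Finset.mul_sum]
        rw [Finset.sum_comm]
        exact Finset.sum_congr rfl fun k' _ => Finset.sum_congr rfl fun l' _ => by ring
      simp only [Matrix.map_apply, e1, e2]
      rw [sum_comm_four]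
    · exact mul_le_mul_of_nonneg_left (mul_le_mul (hcomb hf g) (hcomb hu g') (l2_nonneg _)
        (l2_nonneg _)) (by positivity)
  -- On the standard basis `matForm X` takes the entries of `X` as values, which are those of
  -- `dualForm v` on `f` and `u`.
  have hb := (EuclideanSpace.basisFun (Fin n) ℂ).orthonormal.isBessel
  have h2 := haagerupBound_matForm X _ _ s t hb hb hs ht
  simp only [matForm_basisFun] at h2
  refine h2.trans ?_
  gcongr
  exact mul_nonneg (l2_nonneg _) (l2_nonneg _)

/-- The case of `1 × 1` matrices. Continuity is what provides the Riesz vectors in `dualForm`. -/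
theorem norm_le_of_cbNorm_le {V : OH I →ₗ[ℂ] F} {M : ℝ≥0} (h : cbNorm V ≤ M) (x : OH I) :
    ‖(V x : F.H →L[ℂ] F.H)‖ ≤ M * ‖x‖ := by
  let X : Matrix (Fin 1) (Fin 1) (OH I) := Matrix.of fun _ _ => x
  have h1 : (matNorm X : ℝ) ≤ ‖x‖ := by
    rw [← sq_le_sq₀ (NNReal.coe_nonneg _) (norm_nonneg _), matNorm_OH_sq]
    refine norm_ohGram_le_of_coeff X (sq_nonneg _) fun g g' => ?_
    simp only [Finset.univ_unique, Finset.sum_singleton, matForm_apply, inner_smul_right, l2, X,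
      Matrix.of_apply, norm_mul, RCLike.norm_conj, EuclideanSpace.norm_eq, Real.sqrt_sq_eq_abs,
      abs_norm, inner_self_eq_norm_sq_to_K, Complex.coe_algebraMap, norm_pow, Complex.norm_real,
      norm_norm]
    exact le_of_eq (mul_comm _ _)
  have h2 := (matNorm_operatorSpace_le_iff (X.map V) (by positivity)).1
    (matNorm_map_le_of_cbNorm_le h X)
  refine opNorm_le_of_norm_inner_le _ (by positivity) fun f u => ?_
  have h3 := h2 (fun _ => f) (fun _ => u)
  simp only [Finset.univ_unique, Finset.sum_singleton, l2, Real.sqrt_sq_eq_abs, abs_norm] at h3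
  exact h3.trans (by gcongr)

theorem exists_clm_of_cbNorm_le {V : OH I →ₗ[ℂ] F} {M : ℝ≥0} (h : cbNorm V ≤ M) :
    ∃ v : OH I →L[ℂ] F.H →L[ℂ] F.H, ∀ x, (V x : F.H →L[ℂ] F.H) = v x :=
  ⟨(F.carrier.subtype ∘ₗ V).mkContinuous M (norm_le_of_cbNorm_le h), fun _ => rfl⟩

/-- The squared norms of the Riesz vectors are subadditive, as `(p₁, p₂)` is isometric into the
Hilbert sum; therefore the Haagerup bounds `M₁²` and `M₂²` add. -/
theorem cbNorm_add_comp_le {B : Type u} {V₁ : OH I →ₗ[ℂ] F} {V₂ : OH J →ₗ[ℂ] F} {M₁ M₂ : ℝ≥0}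
    (h₁ : cbNorm V₁ ≤ M₁) (h₂ : cbNorm V₂ ≤ M₂) {p₁ : OH B →L[ℂ] OH I} {p₂ : OH B →L[ℂ] OH J}
    (hp : ∀ x, ‖p₁ x‖ ^ 2 + ‖p₂ x‖ ^ 2 = ‖x‖ ^ 2) {M : ℝ≥0} (hM : M₁ ^ 2 + M₂ ^ 2 = M ^ 2) :
    cbNorm (V₁ ∘ₗ (p₁ : OH B →ₗ[ℂ] OH I) + V₂ ∘ₗ (p₂ : OH B →ₗ[ℂ] OH J)) ≤ M := by
  obtain ⟨v₁, hv₁⟩ := exists_clm_of_cbNorm_le h₁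
  obtain ⟨v₂, hv₂⟩ := exists_clm_of_cbNorm_le h₂
  refine cbNorm_le_of_haagerupBound (v := v₁ ∘L p₁ + v₂ ∘L p₂) (fun x => by simp [hv₁, hv₂]) ?_
  intro ι κ _ _ f u s t hf hu hs ht
  have key : ∀ f u : F.H, ‖dualForm (v₁ ∘L p₁ + v₂ ∘L p₂) f u‖ ^ 2 ≤
      ‖dualForm v₁ f u‖ ^ 2 + ‖dualForm v₂ f u‖ ^ 2 := by
    intro f u
    set R : OH B := ConjSpace.unbar (dualForm (v₁ ∘L p₁ + v₂ ∘L p₂) f u) with hR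
    change ‖R‖ ^ 2 ≤ _
    have e1 : ⟪R, R⟫_ℂ = ⟪f, v₁ (p₁ R) u⟫_ℂ + ⟪f, v₂ (p₂ R) u⟫_ℂ := by
      have := inner_bar_dualForm (v₁ ∘L p₁ + v₂ ∘L p₂) f u R
      refine this.trans ?_
      simp
    have e2 : ‖⟪f, v₁ (p₁ R) u⟫_ℂ‖ ≤ ‖p₁ R‖ * ‖dualForm v₁ f u‖ := by
      rw [← inner_bar_dualForm]; exact norm_inner_le_norm _ _
    have e3 : ‖⟪f, v₂ (p₂ R) u⟫_ℂ‖ ≤ ‖p₂ R‖ * ‖dualForm v₂ f u‖ := by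
      rw [← inner_bar_dualForm]; exact norm_inner_le_norm _ _
    have e4 : ‖R‖ ^ 2 ≤ ‖p₁ R‖ * ‖dualForm v₁ f u‖ + ‖p₂ R‖ * ‖dualForm v₂ f u‖ := by
      have : ‖R‖ ^ 2 = ‖⟪R, R⟫_ℂ‖ := by rw [inner_self_eq_norm_sq_to_K]; simp
      rw [this, e1]
      exact (norm_add_le _ _).trans (add_le_add e2 e3)
    have e5 := hp R
    -- By `2ab ≤ a² + b²` in `e4`, and `e5`, half of `‖R‖²` is absorbed on the left.
    nlinarith [sq_nonneg (‖p₁ R‖ - ‖dualForm v₁ f u‖), sq_nonneg (‖p₂ R‖ - ‖dualForm v₂ f u‖)]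
  have hM' : (M : ℝ) ^ 2 = (M₁ : ℝ) ^ 2 + (M₂ : ℝ) ^ 2 := by exact_mod_cast hM.symm
  rw [hM', add_mul]
  refine le_trans ?_ (add_le_add
    (haagerupBound_of_cbNorm_le hv₁ h₁ f u s t hf hu hs ht)
    (haagerupBound_of_cbNorm_le hv₂ h₂ f u s t hf hu hs ht))
  rw [← Finset.sum_add_distrib]
  refine Finset.sum_le_sum fun p _ => ?_
  rw [← Finset.sum_add_distrib]
  refine Finset.sum_le_sum fun q _ => ?_
  rw [← mul_add]
  exact mul_le_mul_of_nonneg_left (key _ _) (mul_nonneg (hs p) (ht q))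

end OHMaps

/-! ### The ideal norm `δ` -/

section Delta

variable {D E F G : OperatorSpace.{u}}

theorem delta_le {I : Type u} {T : E →ₗ[ℂ] F} (w : E →ₗ[ℂ] OH I) (v : OH I →ₗ[ℂ] F)
    (h : v ∘ₗ w = T) : delta E F T ≤ cbNorm v * pi2oh w :=
  iInf_le_of_le I (iInf_le_of_le w (iInf_le_of_le v (iInf_le_of_le h le_rfl)))

theorem le_delta {T : E →ₗ[ℂ] F} {c : ℝ≥0∞}
    (h : ∀ (I : Type u) (w : E →ₗ[ℂ] OH I) (v : OH I →ₗ[ℂ] F), v ∘ₗ w = T →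
      c ≤ cbNorm v * pi2oh w) : c ≤ delta E F T :=
  le_iInf fun I => le_iInf fun w => le_iInf fun v => le_iInf fun hvw => h I w v hvw

theorem delta_zero : delta E F (0 : E →ₗ[ℂ] F) = 0 := by
  refine nonpos_iff_eq_zero.1 ((delta_le (I := PEmpty) 0 0 (by simp)).trans ?_)
  rw [cbNorm_zero, zero_mul]

theorem cbNorm_le_delta (T : E →ₗ[ℂ] F) : cbNorm T ≤ delta E F T := by
  refine le_delta fun I w v h => ?_
  rw [← h]
  refine (cbNorm_comp_le v w).trans ?_
  gcongr
  exact cbNorm_le_pi2oh w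

theorem delta_eq_zero_iff (T : E →ₗ[ℂ] F) : delta E F T = 0 ↔ T = 0 :=
  ⟨fun h => eq_zero_of_cbNorm (nonpos_iff_eq_zero.1 (h ▸ cbNorm_le_delta T)),
    fun h => h ▸ delta_zero⟩

/-- To bound `δ` by a multiple of `δ(T)` it suffices to consider factorizations of `T`. -/
theorem le_mul_delta {T : E →ₗ[ℂ] F} {k c : ℝ≥0∞} (hk0 : k ≠ 0) (hk : k ≠ ∞)
    (h : ∀ (I : Type u) (w : E →ₗ[ℂ] OH I) (v : OH I →ₗ[ℂ] F), v ∘ₗ w = T →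
      c ≤ k * (cbNorm v * pi2oh w)) : c ≤ k * delta E F T := by
  simp only [delta, ENNReal.mul_iInf_of_ne hk0 hk]
  exact le_iInf fun I => le_iInf fun w => le_iInf fun v => le_iInf fun hvw => h I w v hvw

/-- Excluding `cbNorm a = 0` keeps the right side infinite when `pi2oh w = ∞`. -/
theorem pi2oh_comp_le {Y : Type*} [NormedAddCommGroup Y] [NormedSpace ℂ Y] (w : E →ₗ[ℂ] Y)
    (a : D →ₗ[ℂ] E) (h0 : cbNorm a ≠ 0) (ha : cbNorm a ≠ ∞) :
    pi2oh (w ∘ₗ a) ≤ cbNorm a * pi2oh w := by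
  rcases eq_or_ne (pi2oh w) ∞ with hw | hw
  · rw [hw, ENNReal.mul_top h0]; exact le_top
  · have h1 := (isSummingBound_pi2oh hw).comp (a := a) (C := (cbNorm a).toNNReal)
      (ENNReal.coe_toNNReal ha).ge
    have h2 : pi2oh (w ∘ₗ a) ≤ (((cbNorm a).toNNReal * (pi2oh w).toNNReal : ℝ≥0) : ℝ≥0∞) :=
      pi2oh_le (by exact_mod_cast h1)
    rwa [ENNReal.coe_mul, ENNReal.coe_toNNReal ha, ENNReal.coe_toNNReal hw] at h2

theorem delta_comp_le (a : D →ₗ[ℂ] E) (T : E →ₗ[ℂ] F) (b : F →ₗ[ℂ] G) (ha : cbNorm a < ∞)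
    (hb : cbNorm b < ∞) : delta D G (b ∘ₗ T ∘ₗ a) ≤ cbNorm b * delta E F T * cbNorm a := by
  rcases eq_or_ne (cbNorm a) 0 with ha0 | ha0
  · rw [eq_zero_of_cbNorm ha0, LinearMap.comp_zero, LinearMap.comp_zero, delta_zero]
    exact zero_le
  rcases eq_or_ne (cbNorm b) 0 with hb0 | hb0
  · rw [eq_zero_of_cbNorm hb0, LinearMap.zero_comp, delta_zero]
    exact zero_le
  rw [mul_right_comm]
  refine le_mul_delta (mul_ne_zero hb0 ha0) (ENNReal.mul_ne_top hb.ne ha.ne) fun I w v h => ?_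
  refine (delta_le (w ∘ₗ a) (b ∘ₗ v) (by rw [← h]; rfl)).trans ?_
  calc cbNorm (b ∘ₗ v) * pi2oh (w ∘ₗ a)
      ≤ (cbNorm b * cbNorm v) * (cbNorm a * pi2oh w) := by
        gcongr
        · exact cbNorm_comp_le b v
        · exact pi2oh_comp_le w a ha0 ha.ne
    _ = _ := by ring

theorem delta_smul_le (c : ℂ) (T : E →ₗ[ℂ] F) : delta E F (c • T) ≤ ‖c‖ₑ * delta E F T := by
  rcases eq_or_ne c 0 with rfl | hc
  · rw [zero_smul, delta_zero]; exact zero_le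
  refine le_mul_delta (by simpa using hc) (by simp) fun I w v h => ?_
  refine (delta_le w (c • v) (by rw [← h]; rfl)).trans ?_
  rw [← mul_assoc]
  gcongr
  exact cbNorm_smul_le c v

theorem delta_smul (c : ℂ) (T : E →ₗ[ℂ] F) : delta E F (c • T) = ‖c‖ₑ * delta E F T := by
  refine le_antisymm (delta_smul_le c T) ?_
  rcases eq_or_ne c 0 with rfl | hc
  · simp
  have h := delta_smul_le c⁻¹ (c • T)
  rw [smul_smul, inv_mul_cancel₀ hc, one_smul] at h
  calc ‖c‖ₑ * delta E F T ≤ ‖c‖ₑ * (‖c⁻¹‖ₑ * delta E F (c • T)) := by gcongr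
    _ = delta E F (c • T) := by
      rw [← mul_assoc, ← enorm_mul, mul_inv_cancel₀ hc, enorm_one, one_mul]

/-! ### Hilbert spaces as `OH(B)`, and the triangle inequality -/

/-- The Hilbert sum of `OH(I)` and `OH(J)` is some `OH(B)`. -/
theorem exists_OH_prod (I J : Type u) : ∃ (B : Type u) (p₁ : OH B →L[ℂ] OH I)
    (p₂ : OH B →L[ℂ] OH J) (q : OH I × OH J →ₗ[ℂ] OH B),
    (∀ x, ‖p₁ x‖ ^ 2 + ‖p₂ x‖ ^ 2 = ‖x‖ ^ 2) ∧ (∀ z, p₁ (q z) = z.1) ∧ ∀ z, p₂ (q z) = z.2 := by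
  obtain ⟨B, b, -⟩ := exists_hilbertBasis ℂ (WithLp 2 (OH I × OH J))
  let U := b.repr
  refine ⟨B, WithLp.fstL 2 ℂ (OH I) (OH J) ∘L (U.symm.toContinuousLinearEquiv : OH B →L[ℂ] _),
    WithLp.sndL 2 ℂ (OH I) (OH J) ∘L (U.symm.toContinuousLinearEquiv : OH B →L[ℂ] _),
    U.toLinearEquiv.toLinearMap ∘ₗ
      (WithLp.linearEquiv 2 ℂ (OH I × OH J)).symm.toLinearMap, fun x => ?_,
    fun z => ?_, fun z => ?_⟩
  · rw [← U.symm.norm_map x, WithLp.prod_norm_sq_eq_of_L2]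
    rfl
  · simp
  · simp

/-- A complete subspace of `OH(I)` is isometric to some `OH(B)`. -/
theorem exists_OH_equiv {I : Type u} (K : Submodule ℂ (OH I)) [CompleteSpace K] :
    ∃ B : Type u, Nonempty (K ≃ₗᵢ[ℂ] OH B) := by
  obtain ⟨B, b, -⟩ := exists_hilbertBasis ℂ K
  exact ⟨B, ⟨b.repr⟩⟩

theorem delta_add_le_of_factorization {I J : Type u} (w₁ : E →ₗ[ℂ] OH I) (v₁ : OH I →ₗ[ℂ] F)
    (w₂ : E →ₗ[ℂ] OH J) (v₂ : OH J →ₗ[ℂ] F) :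
    delta E F (v₁ ∘ₗ w₁ + v₂ ∘ₗ w₂) ≤ cbNorm v₁ * pi2oh w₁ + cbNorm v₂ * pi2oh w₂ := by
  have hzero : ∀ {L : Type u} (w : E →ₗ[ℂ] OH L) (v : OH L →ₗ[ℂ] F),
      cbNorm v * pi2oh w = 0 → v ∘ₗ w = 0 := by
    intro L w v h
    rcases mul_eq_zero.1 h with h | h
    · rw [eq_zero_of_cbNorm h, LinearMap.zero_comp]
    · rw [eq_zero_of_pi2oh h, LinearMap.comp_zero]
  rcases eq_or_ne (cbNorm v₁ * pi2oh w₁) 0 with h₁ | h₁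
  · rw [hzero w₁ v₁ h₁, h₁, zero_add, zero_add]; exact delta_le _ _ rfl
  rcases eq_or_ne (cbNorm v₂ * pi2oh w₂) 0 with h₂ | h₂
  · rw [hzero w₂ v₂ h₂, h₂, add_zero, add_zero]; exact delta_le _ _ rfl
  rcases eq_or_ne (cbNorm v₁ * pi2oh w₁) ∞ with t₁ | t₁
  · rw [t₁, top_add]; exact le_top
  rcases eq_or_ne (cbNorm v₂ * pi2oh w₂) ∞ with t₂ | t₂
  · rw [t₂, add_top]; exact le_top
  -- Balancing: the two constants of a factorization are made equal to a common `M`, with `M²` their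
  -- product. This needs both to be nonzero and finite.
  have hbal : ∀ {L : Type u} (w : E →ₗ[ℂ] OH L) (v : OH L →ₗ[ℂ] F), cbNorm v * pi2oh w ≠ 0 →
      cbNorm v * pi2oh w ≠ ∞ → ∃ (w' : E →ₗ[ℂ] OH L) (v' : OH L →ₗ[ℂ] F) (M : ℝ≥0),
        v' ∘ₗ w' = v ∘ₗ w ∧ cbNorm v' ≤ M ∧ IsSummingBound w' M ∧
        ((M ^ 2 : ℝ≥0) : ℝ≥0∞) = cbNorm v * pi2oh w := by
    intro L w v h0 ht
    have hv0 := left_ne_zero_of_mul h0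
    have hw0 := right_ne_zero_of_mul h0
    have hvt : cbNorm v ≠ ∞ := fun h => ht (by rw [h, ENNReal.top_mul hw0])
    have hwt : pi2oh w ≠ ∞ := fun h => ht (by rw [h, ENNReal.mul_top hv0])
    have hs := isSummingBound_pi2oh hwt
    obtain ⟨a, ha⟩ : ∃ a : ℝ≥0, (a : ℝ≥0∞) = cbNorm v := ⟨_, ENNReal.coe_toNNReal hvt⟩
    obtain ⟨b, hb⟩ : ∃ b : ℝ≥0, (b : ℝ≥0∞) = pi2oh w := ⟨_, ENNReal.coe_toNNReal hwt⟩
    rw [← hb, ENNReal.coe_toReal] at hs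
    rw [← ha] at hv0
    rw [← hb] at hw0
    have ha0 : a ≠ 0 := by exact_mod_cast hv0
    have hb0 : b ≠ 0 := by exact_mod_cast hw0
    let r : ℝ≥0 := NNReal.sqrt a
    let q : ℝ≥0 := NNReal.sqrt b
    have hr : r * r = a := NNReal.mul_self_sqrt a
    have hq : q * q = b := NNReal.mul_self_sqrt b
    have hr0 : r ≠ 0 := by simpa [r] using ha0
    have hq0 : q ≠ 0 := by simpa [q] using hb0
    -- Scaling `v` by `√(b / a)` and `w` by its inverse turns both constants into `√(a * b)`.
    let l : ℝ≥0 := q / r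
    have hl : (((l : ℝ) : ℂ)) ≠ 0 := by
      simpa [l] using ⟨hq0, hr0⟩
    refine ⟨((l : ℝ) : ℂ)⁻¹ • w, ((l : ℝ) : ℂ) • v, r * q, ?_, ?_, ?_, ?_⟩
    · rw [LinearMap.smul_comp, LinearMap.comp_smul, smul_smul, mul_inv_cancel₀ hl, one_smul]
    · refine (cbNorm_smul_le _ v).trans (le_of_eq ?_)
      have : ‖((l : ℝ) : ℂ)‖ₑ = (l : ℝ≥0∞) := by
        rw [enorm_eq_nnnorm]; congr 1; ext; simp
      rw [this, ← ha, ← ENNReal.coe_mul, ← hr]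
      congr 1
      simp only [l]
      field_simp
    · intro ι _ x
      have h3 := hs x
      have hl' : (l : ℝ)⁻¹ * b = r * q := by
        have : l⁻¹ * b = r * q := by rw [← hq]; simp only [l]; field_simp
        exact_mod_cast this
      have h4 : ∀ i, ‖((((l : ℝ) : ℂ)⁻¹) • w) (x i)‖ ^ 2 = (l : ℝ)⁻¹ ^ 2 * ‖w (x i)‖ ^ 2 := by
        intro i
        rw [LinearMap.smul_apply, norm_smul, mul_pow]
        simp
      simp only [h4]
      rw [← Finset.mul_sum, NNReal.coe_mul, ← hl', mul_pow, mul_assoc]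
      exact mul_le_mul_of_nonneg_left h3 (sq_nonneg _)
    · rw [← ha, ← hb, ← ENNReal.coe_mul, ← hr, ← hq]
      congr 1
      ring
  obtain ⟨w₁', v₁', M₁, e₁, c₁, s₁, m₁⟩ := hbal w₁ v₁ h₁ t₁
  obtain ⟨w₂', v₂', M₂, e₂, c₂, s₂, m₂⟩ := hbal w₂ v₂ h₂ t₂
  obtain ⟨B, p₁, p₂, q, hp, hq₁, hq₂⟩ := exists_OH_prod I J
  -- Both the cb norm and the summing norm of the joined factorization are at most this `M`, so
  -- their product is at most `M₁² + M₂²`, the sum of the two original products.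
  let M : ℝ≥0 := NNReal.sqrt (M₁ ^ 2 + M₂ ^ 2)
  have hM : M₁ ^ 2 + M₂ ^ 2 = M ^ 2 := (NNReal.sq_sqrt _).symm
  have hW : IsSummingBound (q ∘ₗ w₁'.prod w₂') M := by
    intro ι _ x
    have h3 : ∀ i, ‖(q ∘ₗ w₁'.prod w₂') (x i)‖ ^ 2 = ‖w₁' (x i)‖ ^ 2 + ‖w₂' (x i)‖ ^ 2 := by
      intro i
      rw [← hp, LinearMap.comp_apply, hq₁, hq₂]
      rfl
    have hM' : (M : ℝ) ^ 2 = (M₁ : ℝ) ^ 2 + (M₂ : ℝ) ^ 2 := by exact_mod_cast hM.symm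
    simp only [h3]
    rw [Finset.sum_add_distrib, hM', add_mul]
    exact add_le_add (s₁ x) (s₂ x)
  have hV := cbNorm_add_comp_le c₁ c₂ hp hM
  refine (delta_le _ _ ?_).trans ((mul_le_mul' hV (pi2oh_le hW)).trans (le_of_eq ?_))
  · rw [← e₁, ← e₂]
    ext x : 1
    simp [hq₁, hq₂]
  · rw [← m₁, ← m₂, ← ENNReal.coe_mul, ← sq, ← hM, ENNReal.coe_add]

theorem delta_add_le (S T : E →ₗ[ℂ] F) : delta E F (S + T) ≤ delta E F S + delta E F T := by
  conv_rhs => rw [delta, delta]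
  simp only [ENNReal.iInf_add, ENNReal.add_iInf]
  refine le_iInf fun I => le_iInf fun w₂ => le_iInf fun v₂ => le_iInf fun h₂ => ?_
  refine le_iInf fun J => le_iInf fun w₁ => le_iInf fun v₁ => le_iInf fun h₁ => ?_
  rw [← h₁, ← h₂]
  exact delta_add_le_of_factorization w₁ v₁ w₂ v₂

/-! ### 1-injectivity -/

theorem IsCompleteIsometry.norm_map {i : F →ₗ[ℂ] G} (hi : IsCompleteIsometry i) (y : F) :
    ‖i y‖ = ‖y‖ := by
  have h : ∀ {A : OperatorSpace.{u}} (z : A),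
      (matNorm (Matrix.of fun _ _ : Fin 1 => z) : ℝ) = ‖z‖ := by
    intro A z
    refine le_antisymm ?_ ?_
    · refine (matNorm_operatorSpace_le_iff _ (norm_nonneg _)).2 fun g g' => ?_
      simp only [Finset.univ_unique, Finset.sum_singleton, l2, Real.sqrt_sq_eq_abs, abs_norm]
      exact norm_inner_apply_le _ _ _
    · refine opNorm_le_of_norm_inner_le _ (NNReal.coe_nonneg _) fun f g => ?_
      have := (matNorm_operatorSpace_le_iff (Matrix.of fun _ _ : Fin 1 => z)
        (NNReal.coe_nonneg _)).1 le_rfl (fun _ => f) (fun _ => g)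
      simp only [Finset.univ_unique, Finset.sum_singleton, l2, Real.sqrt_sq_eq_abs, abs_norm]
        at this
      exact this
  rw [← h, ← h, ← hi 1 (Matrix.of fun _ _ => y)]
  rfl

theorem isOneInjective_delta : IsOneInjective delta.{u} := by
  intro E F G T i hi
  have hinj : Function.Injective i := by
    refine (injective_iff_map_eq_zero i).2 fun y hy => ?_
    rw [← norm_eq_zero, ← hi.norm_map, hy, norm_zero]
  refine le_antisymm ?_ (le_delta fun I w v h => ?_)
  · have hid : cbNorm (LinearMap.id : E →ₗ[ℂ] E) ≤ 1 :=
      IsCompleteIsometry.cbNorm_le_one fun n x => congrArg matNorm (by ext; simp)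
    have := delta_comp_le LinearMap.id T i (hid.trans_lt ENNReal.one_lt_top)
      (hi.cbNorm_le_one.trans_lt ENNReal.one_lt_top)
    rw [LinearMap.comp_id] at this
    refine this.trans ?_
    calc cbNorm i * delta E F T * cbNorm (LinearMap.id : E →ₗ[ℂ] E)
        ≤ 1 * delta E F T * 1 := by gcongr; exact hi.cbNorm_le_one
      _ = delta E F T := by simp
  · rcases eq_or_ne (cbNorm v) ∞ with hv | hv
    -- The product is `∞` unless `pi2oh w = 0`. In that case `0 * ∞ = 0`, but `w = 0` and
    -- injectivity of `i` force `T = 0`.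
    · rcases eq_or_ne (pi2oh w) 0 with hw | hw
      · have hT : T = 0 := by
          rw [eq_zero_of_pi2oh hw, LinearMap.comp_zero] at h
          ext x : 1
          apply hinj
          simpa using (LinearMap.congr_fun h x).symm
        rw [hT, delta_zero]
        exact zero_le
      · rw [hv, ENNReal.top_mul hw]; exact le_top
    -- On the range of `w` the map `v` has values in the range of `i`. This persists on the closure,
    -- since `v` is continuous and the range of `i` is closed by completeness of `F`; the closure is
    -- needed for a Hilbert space.
    · let K := (LinearMap.range w).topologicalClosure
      have hK : IsClosed (K : Set (OH I)) := Submodule.isClosed_topologicalClosure _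
      have : CompleteSpace K := hK.completeSpace_coe
      obtain ⟨B, ⟨U⟩⟩ := exists_OH_equiv K
      have hvc : Continuous v := by
        obtain ⟨v', hv'⟩ := exists_clm_of_cbNorm_le (V := v) (M := (cbNorm v).toNNReal)
          (ENNReal.coe_toNNReal hv).ge
        refine continuous_induced_rng.2 ?_
        have : (Subtype.val ∘ v) = v' := funext hv'
        rw [this]
        exact v'.continuous
      have : CompleteSpace F := F.isClosed_carrier.completeSpace_coe
      have hiso : Isometry i := AddMonoidHomClass.isometry_of_norm i hi.norm_map
      have hrange : ∀ x : K, v x ∈ LinearMap.range i := by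
        intro x
        have hc : IsClosed (LinearMap.range i : Set G) := hiso.isClosedEmbedding.isClosed_range
        have hsub : (K : Set (OH I)) ⊆ v ⁻¹' (LinearMap.range i : Set G) := by
          refine closure_minimal ?_ (hc.preimage hvc)
          rintro _ ⟨y, rfl⟩
          exact ⟨T y, (LinearMap.congr_fun h y).symm⟩
        exact hsub x.2
      let j := LinearEquiv.ofInjective i hinj
      let vK : K →ₗ[ℂ] LinearMap.range i := (v ∘ₗ K.subtype).codRestrict _ hrange
      let wK : E →ₗ[ℂ] K := w.codRestrict K fun x =>
        Submodule.le_topologicalClosure _ ⟨x, rfl⟩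
      let v' : OH B →ₗ[ℂ] F := j.symm.toLinearMap ∘ₗ vK ∘ₗ U.symm.toLinearEquiv.toLinearMap
      let w' : E →ₗ[ℂ] OH B := U.toLinearEquiv.toLinearMap ∘ₗ wK
      have hiv : ∀ x, i (v' x) = v (U.symm x : K) := fun x =>
        congrArg Subtype.val (j.apply_symm_apply (vK (U.symm x)))
      have hvw : v' ∘ₗ w' = T := by
        ext x : 1
        apply hinj
        have h1 : i (v' (w' x)) = v (w x) := by
          rw [hiv]
          simp [w', wK]
        exact h1.trans (LinearMap.congr_fun h x)
      have hv' : cbNorm v' ≤ cbNorm v := by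
        refine cbNorm_le fun n X => ?_
        have e1 : matNorm (X.map v') = matNorm ((X.map fun x => (U.symm x : OH I)).map v) := by
          rw [← hi n]
          congr 1
          exact Matrix.ext fun k l => hiv (X k l)
        -- The matrix norms of `OH` depend on inner products only, so the Hilbert space isometry `U`
        -- is automatically completely isometric.
        have e2 : matNorm (X.map fun x => (U.symm x : OH I)) = matNorm X := by
          have : ohGram (X.map fun x => (U.symm x : OH I)) = ohGram X := by
            ext p q
            simp only [ohGram, Matrix.of_apply, Matrix.map_apply]
            rw [← Submodule.coe_inner, U.symm.inner_map_map]
          change NNReal.sqrt _ = NNReal.sqrt _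
          rw [this]
        rw [e1, ← e2]
        exact matNorm_map_le v _
      have hw' : pi2oh w' ≤ pi2oh w := by
        refine le_pi2oh fun C hC => pi2oh_le fun ι _ x => ?_
        have : ∀ x, ‖w' x‖ = ‖w x‖ := fun x => U.norm_map (wK x)
        simpa only [this] using hC x
      exact (delta_le w' v' hvw).trans (mul_le_mul' hv' hw')

end Delta

end

theorem mainTheorem4 : IsOperatorIdealNorm delta.{u} ∧ IsOneInjective delta.{u} :=
  ⟨{  eq_zero_iff := fun _ _ => delta_eq_zero_iff
      smul := fun _ _ => delta_smul
      add_le := fun _ _ => delta_add_le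
      cbNorm_le := fun _ _ => cbNorm_le_delta
      ideal := fun _ _ _ _ => delta_comp_le }, isOneInjective_delta⟩
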